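/- Let $M$ be a compact connected surface (a two-dimensional manifold of class $C^r$, $r\ge 3$) and let $x:M\to\mathbb{R}^3$ be a $C^r$ immersion with positive Gaussian curvature $K_I$ (an ovaloid). Let $\xi$ be the unit normal field along $x$ for which the second fundamental form $II$, with components $h_{ij}=\langle \xi,\partial_i\partial_j x\rangle$, is positive definite, and let $dO_{II}=\sqrt{\det(h_{ij})}\,du^1du^2$ be the area element of $II$. A $C^s$ map $y:M\to\mathbb{R}^3$ $(1\le s<r)$ is a relative normalization of $x$ if at every point, in local coordinates $(u^1,u^2)$, $\operatorname{rank}\{\partial_1x,\partial_2x,y\}=3$ and $\operatorname{rank}\{\partial_1x,\partial_2x,\partial_iy\}=2$ for $i=1,2$. Its support function is the nowhere vanishing function $q=\langle\xi,y\rangle$, its relative shape operator $(B_i^j)$ is defined by $\partial_iy=-\sum_jB_i^j\,\partial_jx$, and its relative mean curvature is $H=\tfrac12\operatorname{tr}(B_i^j)$. The equiaffine normalization is $$y_{\mathrm{aff}}=q_{\mathrm{aff}}\,\xi-\sum_{i,j}h^{(ij)}\,\partial_iq_{\mathrm{aff}}\,\partial_jx,\qquad q_{\mathrm{aff}}=|K_I|^{1/4},$$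 where $(h^{(ij)})$ is the inverse matrix of $(h_{ij})$; its support function is $q_{\mathrm{aff}}$, and $H_{\mathrm{aff}}$ denotes its relative mean curvature. If $r=3$, assume in addition that $y_{\mathrm{aff}}$ is of class $C^1$, so that $H_{\mathrm{aff}}$ is defined (for $r\ge4$ this is automatic). Then, for every $C^s$ relative normalization $y$ of $x$, the function $\frac{H}{q}-\frac{H_{\mathrm{aff}}}{q_{\mathrm{aff}}}$ is integrable with respect to $dO_{II}$, and $$\iint_M\left(\frac{H}{q}-\frac{H_{\mathrm{aff}}}{q_{\mathrm{aff}}}\right)dO_{II}\ \ge\ 0 .$$ Equality holds if and only if there is a constant $c\in\mathbb{R}\setminus\{0\}$ such that $y=c\,y_{\mathrm{aff}}$ on $M$. -/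

import Mathlib

open scoped Manifold ContDiff
open MeasureTheory

namespace RelSurface

/-- The Euclidean plane (the model space of a surface). -/
abbrev E2 : Type := EuclideanSpace ℝ (Fin 2)

/-- Euclidean 3-space. -/
abbrev E3 : Type := EuclideanSpace ℝ (Fin 3)

noncomputable section

variable {M : Type*} [TopologicalSpace M]

/-- The partial derivative `∂f/∂uⁱ` at the point `p`, in the chart `e`, of a map `f` on the
surface. Second partial derivatives are obtained by iterating. -/
def pd {F : Type*} [NormedAddCommGroup F] [NormedSpace ℝ F]
    (e : OpenPartialHomeomorph M E2) (f : M → F) (i : Fin 2) (p : M) : F :=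
  fderiv ℝ (f ∘ e.symm) (e p) (EuclideanSpace.single i 1)

/-- The matrix `g_{ij} = ⟨x_{/i}, x_{/j}⟩` of the first fundamental form in the chart `e`. -/
def firstForm (e : OpenPartialHomeomorph M E2) (x : M → E3) (p : M) : Matrix (Fin 2) (Fin 2) ℝ :=
  Matrix.of fun i j => inner ℝ (pd e x i p) (pd e x j p)

/-- The matrix `h_{ij} = ⟨ξ, x_{/ij}⟩` of the second fundamental form `II`, with respect to the
unit normal field `ξ`, in the chart `e`. -/
def secondForm (e : OpenPartialHomeomorph M E2) (x ξ : M → E3) (p : M) :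
    Matrix (Fin 2) (Fin 2) ℝ :=
  Matrix.of fun i j => inner ℝ (ξ p) (pd e (pd e x i) j p)

/-- The matrix `(B_i^j)` of the relative shape operator in the chart `e`, i.e. the coefficients in
`y_{/i} = - ∑ j, B_i^j x_{/j}`; explicitly `B_i^j = - ∑ k, ⟨y_{/i}, x_{/k}⟩ g^{kj}`. -/
def shapeCoeff (e : OpenPartialHomeomorph M E2) (x y : M → E3) (p : M) :
    Matrix (Fin 2) (Fin 2) ℝ :=
  -((Matrix.of fun i k => inner ℝ (pd e y i p) (pd e x k p)) * (firstForm e x p)⁻¹)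

/-- `shapeCoeff` is the unique matrix with `y_{/i} = - ∑ j, B_i^j x_{/j}`. -/
theorem eq_shapeCoeff (e : OpenPartialHomeomorph M E2) (x y : M → E3) (p : M)
    (hx : LinearIndependent ℝ fun i => pd e x i p) (B : Matrix (Fin 2) (Fin 2) ℝ)
    (hB : ∀ i, pd e y i p = -∑ j, B i j • pd e x j p) : shapeCoeff e x y p = B := by
  have hg : IsUnit (firstForm e x p).det :=
    (Matrix.PosDef.det_pos
      (A := firstForm e x p) (Matrix.posDef_gram_iff_linearIndependent.2 hx)).ne'.isUnit
  have h : (Matrix.of fun i k => inner ℝ (pd e y i p) (pd e x k p)) =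
      -(B * firstForm e x p) := by
    ext i k
    simp [hB, firstForm, Matrix.mul_apply, inner_add_left, inner_smul_left]
  rw [shapeCoeff, h, neg_mul, neg_neg, Matrix.mul_assoc, Matrix.mul_nonsing_inv _ hg,
    Matrix.mul_one]

variable [ChartedSpace E2 M]

/-- The Gaussian curvature `K_I = det (h_{ij}) / det (g_{ij})`. -/
def gaussCurv (x ξ : M → E3) (p : M) : ℝ :=
  (secondForm (chartAt E2 p) x ξ p).det / (firstForm (chartAt E2 p) x p).det

/-- The support function `q = ⟨ξ, y⟩`. -/
def support (ξ y : M → E3) (p : M) : ℝ := inner ℝ (ξ p) (y p)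

/-- The relative mean curvature `H = (1/2) tr (B_i^j)`. -/
def relMeanCurv (x y : M → E3) (p : M) : ℝ :=
  (1 / 2) * (shapeCoeff (chartAt E2 p) x y p).trace

/-- The equiaffine support function `q_aff = |K_I|^(1/4)`. -/
def qAff (x ξ : M → E3) (p : M) : ℝ := |gaussCurv x ξ p| ^ ((1 : ℝ) / 4)

/-- The equiaffine normalization: the relative normalization
`y_aff = q_aff ξ - ∑ i j, h^{(ij)} (q_aff)_{/i} x_{/j}` with support function `q_aff`. -/
def yAff (x ξ : M → E3) (p : M) : E3 :=
  qAff x ξ p • ξ p -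
    ∑ i, ∑ j, ((secondForm (chartAt E2 p) x ξ p)⁻¹ i j * pd (chartAt E2 p) (qAff x ξ) i p) •
      pd (chartAt E2 p) x j p

/-- `x` is a `C^r` immersion of the surface `M` into Euclidean 3-space, `ξ` is a continuous unit
normal field along it (the Euclidean normalization), and the Gaussian curvature is positive.
On a compact connected `M` this describes an ovaloid. -/
structure IsPosCurvedSurface (r : WithTop ℕ∞) (x ξ : M → E3) : Prop where
  contMDiff : ContMDiff (𝓡 2) 𝓘(ℝ, E3) r x
  immersion : ∀ p, Function.Injective (mfderiv (𝓡 2) 𝓘(ℝ, E3) x p)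
  continuous_normal : Continuous ξ
  norm_normal : ∀ p, ‖ξ p‖ = 1
  normal_orthogonal : ∀ p i, inner ℝ (ξ p) (pd (chartAt E2 p) x i p) = 0
  curv_pos : ∀ p, 0 < gaussCurv x ξ p

/-- The support function of the equiaffine normalization is `q_aff`. -/
theorem support_yAff {r : WithTop ℕ∞} {x ξ : M → E3} (hx : IsPosCurvedSurface r x ξ) (p : M) :
    support ξ (yAff x ξ) p = qAff x ξ p := by
  simp [support, yAff, inner_sub_right, inner_add_right, inner_smul_right, hx.normal_orthogonal,
    hx.norm_normal]

/-- `y` is a `C^s` relative normalization of the immersed surface `x`: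
`rank {x_{/1}, x_{/2}, y} = 3` and `rank {x_{/1}, x_{/2}, y_{/i}} = 2` for `i = 1, 2`. -/
structure IsRelativeNormalization (s : WithTop ℕ∞) (x y : M → E3) : Prop where
  contMDiff : ContMDiff (𝓡 2) 𝓘(ℝ, E3) s y
  rank_three : ∀ p,
    Set.finrank ℝ {pd (chartAt E2 p) x 0 p, pd (chartAt E2 p) x 1 p, y p} = 3
  rank_two : ∀ p i,
    Set.finrank ℝ {pd (chartAt E2 p) x 0 p, pd (chartAt E2 p) x 1 p, pd (chartAt E2 p) y i p} = 2

/-- The measure with density `√|det (h_{ij})| du¹ du²` on the domain of the chart `e`, extended by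
zero to the whole surface. -/
def chartAreaII [MeasurableSpace M] (x ξ : M → E3) (e : OpenPartialHomeomorph M E2) : Measure M :=
  (((volume : Measure E2).restrict e.target).withDensity fun u =>
    ENNReal.ofReal √|(secondForm e x ξ (e.symm u)).det|).map e.symm

/-- The area measure `dO_II` of the second fundamental form. By the change of variables formula
the measures `√|det (h_{ij})| du¹ du²` agree on the overlaps of charts; their supremum is the measure
that restricts to each of them on its chart domain. -/
def areaII [MeasurableSpace M] (x ξ : M → E3) : Measure M :=
  ⨆ p : M, chartAreaII x ξ (chartAt E2 p)

end

end RelSurface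

/-!
Let `h` be the second fundamental form. A relative normalization with support function `q` is
`y = q (ξ + T)` with `T` tangent, and as `∂ᵢ y` is tangent, `∂ᵢ q = ⟨∂ᵢ ξ, y⟩ = -q hᵢⱼ Tʲ`; so `T`
is minus the `II`-gradient of `log |q|`. The equiaffine normalization `y_aff = q_aff (ξ + T_aff)`
satisfies the same equation. For the tangent vector field
`Z = q_aff² (y / q - y_aff / q_aff) = q_aff² (T - T_aff)` a pointwise computation gives

`H / q - H_aff / q_aff = -(div Z) / (2 q_aff²) + II (T - T_aff, T - T_aff) / 2`,

where `div` is the divergence with respect to the first fundamental form; in the language of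
relative normalizations `-(div Z) / 2` is `relMeanCurv x Z` (`curvDefect_nonneg_and_eq`). Since
`q_aff⁴ = K_I`, the measure `dO_II / q_aff²` is the area measure of the first fundamental form
(`sqrt_det_secondForm`), so the divergence term integrates to zero over the compact surface
(`integral_relMeanCurv_eq_zero`). The remaining term is continuous and nonnegative. Its integral
vanishes only if `T = T_aff` everywhere, that is, if `log (|q| / q_aff)` has derivative zero; then
`q / q_aff` is constant, as the surface is connected.

The definitions refer to the preferred chart at each point. The passage to other charts rests on
`pd_change`; that `II` transforms as a tensor comes from `hᵢⱼ = -⟨∂ⱼ ξ, ∂ᵢ x⟩`, and the equiaffine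
normalization is characterized without charts by `⟨ξ, y_aff⟩ = q_aff` and
`⟨∂ᵢ ξ, y_aff⟩ = ∂ᵢ q_aff` (`yAff_eq_chartYAff`). The area measure, a supremum over all charts,
agrees on each chart domain with the measure of that chart (`areaII_apply`). The divergence theorem is
reduced to compactly supported functions on the plane by bump functions in charts.

When `r = 3` the field `y_aff` is `C¹` by hypothesis; when `r ≥ 4` it follows from
`chartContDiff_yAff`.
-/

namespace RelSurface

/-! ### Calculus in a chart -/

section ChartCalculus

variable {M : Type*} [TopologicalSpace M]
  {F : Type*} [NormedAddCommGroup F] [NormedSpace ℝ F]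
  {G : Type*} [NormedAddCommGroup G] [InnerProductSpace ℝ G]

/-- `f` is of class `C^k` in the coordinates of the chart `e`. -/
def ChartContDiff (e : OpenPartialHomeomorph M E2) (k : WithTop ℕ∞) (f : M → F) : Prop :=
  ContDiffOn ℝ k (f ∘ e.symm) e.target

variable {e : OpenPartialHomeomorph M E2} {k : WithTop ℕ∞} {p : M}

theorem ChartContDiff.of_le {l : WithTop ℕ∞} {f : M → F} (hf : ChartContDiff e k f) (h : l ≤ k) :
    ChartContDiff e l f :=
  ContDiffOn.of_le hf h

theorem ChartContDiff.contDiffAt {f : M → F} (hf : ChartContDiff e k f) (hp : p ∈ e.source) :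
    ContDiffAt ℝ k (f ∘ e.symm) (e p) :=
  ContDiffOn.contDiffAt hf (e.open_target.mem_nhds (e.map_source hp))

theorem ChartContDiff.differentiableAt {f : M → F} (hf : ChartContDiff e k f) (hk : 1 ≤ k)
    (hp : p ∈ e.source) : DifferentiableAt ℝ (f ∘ e.symm) (e p) :=
  (hf.contDiffAt hp).differentiableAt (by rintro rfl; simp at hk)

omit [NormedAddCommGroup F] [NormedSpace ℝ F] in
theorem eventuallyEq_of_eqOn_source {f g : M → F} (h : ∀ m ∈ e.source, f m = g m)
    (hp : p ∈ e.source) : f ∘ e.symm =ᶠ[nhds (e p)] g ∘ e.symm := by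
  filter_upwards [e.open_target.mem_nhds (e.map_source hp)] with u hu
  exact h _ (e.map_target hu)

theorem ChartContDiff.congr {f g : M → F} (hf : ChartContDiff e k f)
    (h : ∀ m ∈ e.source, g m = f m) : ChartContDiff e k g :=
  ContDiffOn.congr hf fun _ hu => h _ (e.map_target hu)

theorem pd_congr {f g : M → F} (h : ∀ m ∈ e.source, f m = g m) (hp : p ∈ e.source) (i : Fin 2) :
    pd e f i p = pd e g i p := by
  rw [pd, pd, (eventuallyEq_of_eqOn_source h hp).fderiv_eq]

theorem ChartContDiff.pd {l : WithTop ℕ∞} {f : M → F} (hf : ChartContDiff e l f)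
    (hk : k + 1 ≤ l) (i : Fin 2) : ChartContDiff e k (pd e f i) := by
  have h : ContDiffOn ℝ k (fun u => fderiv ℝ (f ∘ e.symm) u (EuclideanSpace.single i 1))
      e.target := (hf.fderiv_of_isOpen e.open_target hk).clm_apply contDiffOn_const
  refine h.congr fun u hu => ?_
  simp [RelSurface.pd, e.right_inv hu]

theorem ChartContDiff.const (c : F) : ChartContDiff e k fun _ => c :=
  contDiffOn_const

theorem ChartContDiff.add {f g : M → F} (hf : ChartContDiff e k f) (hg : ChartContDiff e k g) :
    ChartContDiff e k fun m => f m + g m :=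
  ContDiffOn.add hf hg

theorem ChartContDiff.sub {f g : M → F} (hf : ChartContDiff e k f) (hg : ChartContDiff e k g) :
    ChartContDiff e k fun m => f m - g m :=
  ContDiffOn.sub hf hg

theorem ChartContDiff.mul {f g : M → ℝ} (hf : ChartContDiff e k f) (hg : ChartContDiff e k g) :
    ChartContDiff e k fun m => f m * g m :=
  ContDiffOn.mul hf hg

theorem ChartContDiff.div {f g : M → ℝ} (hf : ChartContDiff e k f) (hg : ChartContDiff e k g)
    (h0 : ∀ m ∈ e.source, g m ≠ 0) : ChartContDiff e k fun m => f m / g m :=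
  ContDiffOn.div hf hg fun _ hu => h0 _ (e.map_target hu)

theorem ChartContDiff.smul {c : M → ℝ} {f : M → F} (hc : ChartContDiff e k c)
    (hf : ChartContDiff e k f) : ChartContDiff e k fun m => c m • f m :=
  ContDiffOn.smul hc hf

theorem ChartContDiff.inner {f g : M → G} (hf : ChartContDiff e k f) (hg : ChartContDiff e k g) :
    ChartContDiff e k fun m => inner ℝ (f m) (g m) :=
  ContDiffOn.inner ℝ hf hg

theorem pd_const (c : F) (i : Fin 2) : pd e (fun _ => c) i p = 0 := by
  have : (fun _ : M => c) ∘ e.symm = fun _ => c := rfl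
  simp [pd, this]

theorem pd_add {f g : M → F} (hf : DifferentiableAt ℝ (f ∘ e.symm) (e p))
    (hg : DifferentiableAt ℝ (g ∘ e.symm) (e p)) (i : Fin 2) :
    pd e (fun m => f m + g m) i p = pd e f i p + pd e g i p := by
  have : (fun m => f m + g m) ∘ e.symm = f ∘ e.symm + g ∘ e.symm := rfl
  rw [pd, this, fderiv_add hf hg]; rfl

theorem pd_sub {f g : M → F} (hf : DifferentiableAt ℝ (f ∘ e.symm) (e p))
    (hg : DifferentiableAt ℝ (g ∘ e.symm) (e p)) (i : Fin 2) :
    pd e (fun m => f m - g m) i p = pd e f i p - pd e g i p := by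
  have : (fun m => f m - g m) ∘ e.symm = f ∘ e.symm - g ∘ e.symm := rfl
  rw [pd, this, fderiv_sub hf hg]; rfl

theorem pd_sum {ι : Type*} (s : Finset ι) {f : ι → M → F}
    (hf : ∀ a ∈ s, DifferentiableAt ℝ (f a ∘ e.symm) (e p)) (i : Fin 2) :
    pd e (fun m => ∑ a ∈ s, f a m) i p = ∑ a ∈ s, pd e (f a) i p := by
  have : (fun m => ∑ a ∈ s, f a m) ∘ e.symm = fun u => ∑ a ∈ s, (f a ∘ e.symm) u := rfl
  rw [pd, this, fderiv_fun_sum hf]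
  simp [pd]

theorem pd_smul {c : M → ℝ} {f : M → F} (hc : DifferentiableAt ℝ (c ∘ e.symm) (e p))
    (hf : DifferentiableAt ℝ (f ∘ e.symm) (e p)) (hp : p ∈ e.source) (i : Fin 2) :
    pd e (fun m => c m • f m) i p = pd e c i p • f p + c p • pd e f i p := by
  have : (fun m => c m • f m) ∘ e.symm = fun u => (c ∘ e.symm) u • (f ∘ e.symm) u := rfl
  rw [pd, this, fderiv_fun_smul hc hf]
  simp [pd, e.left_inv hp, add_comm]

theorem pd_mul {c f : M → ℝ} (hc : DifferentiableAt ℝ (c ∘ e.symm) (e p))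
    (hf : DifferentiableAt ℝ (f ∘ e.symm) (e p)) (hp : p ∈ e.source) (i : Fin 2) :
    pd e (fun m => c m * f m) i p = pd e c i p * f p + c p * pd e f i p :=
  pd_smul hc hf hp i

theorem pd_inner {f g : M → G} (hf : DifferentiableAt ℝ (f ∘ e.symm) (e p))
    (hg : DifferentiableAt ℝ (g ∘ e.symm) (e p)) (hp : p ∈ e.source) (i : Fin 2) :
    pd e (fun m => inner ℝ (f m) (g m)) i p =
      inner ℝ (pd e f i p) (g p) + inner ℝ (f p) (pd e g i p) := by
  have : (fun m => inner ℝ (f m) (g m)) ∘ e.symm =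
    fun u => inner ℝ ((f ∘ e.symm) u) ((g ∘ e.symm) u) := rfl
  rw [pd, this, fderiv_inner_apply ℝ hf hg]
  simp [pd, e.left_inv hp, add_comm]

/-- The chain rule for a function of a real-valued function. -/
theorem pd_comp {φ : ℝ → ℝ} {φ' : ℝ} {f : M → ℝ} (hφ : HasDerivAt φ φ' (f p))
    (hf : DifferentiableAt ℝ (f ∘ e.symm) (e p)) (hp : p ∈ e.source) (i : Fin 2) :
    pd e (fun m => φ (f m)) i p = φ' * pd e f i p := by
  have h1 : HasDerivAt φ φ' ((f ∘ e.symm) (e p)) := by simpa [e.left_inv hp] using hφ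
  have := (h1.comp_hasFDerivAt _ hf.hasFDerivAt).fderiv
  have h2 : (fun m => φ (f m)) ∘ e.symm = φ ∘ (f ∘ e.symm) := rfl
  rw [pd, h2, this]; simp [pd]

/-- Second partial derivatives commute. -/
theorem pd_pd_comm {f : M → F} (hf : ChartContDiff e 2 f) (hp : p ∈ e.source) (i j : Fin 2) :
    pd e (pd e f i) j p = pd e (pd e f j) i p := by
  have hsymm := (hf.contDiffAt hp).isSymmSndFDerivAt (by simp)
  have key : ∀ i j, pd e (pd e f i) j p = fderiv ℝ (fderiv ℝ (f ∘ e.symm)) (e p)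
      (EuclideanSpace.single j 1) (EuclideanSpace.single i 1) := by
    intro i j
    have h1 : pd e f i ∘ e.symm =ᶠ[nhds (e p)]
        fun u => fderiv ℝ (f ∘ e.symm) u (EuclideanSpace.single i 1) := by
      filter_upwards [e.open_target.mem_nhds (e.map_source hp)] with u hu
      simp [pd, e.right_inv hu]
    have h2 : DifferentiableAt ℝ (fderiv ℝ (f ∘ e.symm)) (e p) :=
      ((hf.contDiffAt hp).fderiv_right (m := 1) (by norm_num)).differentiableAt one_ne_zero
    rw [pd, h1.fderiv_eq, fderiv_clm_apply h2 (differentiableAt_const _)]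
    simp
  rw [key, key]
  exact hsymm _ _

end ChartCalculus

/-! ### Change of charts -/

section ChartChange

variable {M : Type*} [TopologicalSpace M] [ChartedSpace E2 M]
  {F : Type*} [NormedAddCommGroup F] [NormedSpace ℝ F]
  {e e' : OpenPartialHomeomorph M E2} {n : WithTop ℕ∞} {p : M}

theorem chartContDiff_of_contMDiff [IsManifold (𝓡 2) n M] {f : M → F}
    (hf : ContMDiff (𝓡 2) 𝓘(ℝ, F) n f) (he : e ∈ atlas E2 M) : ChartContDiff e n f :=
  contMDiffOn_iff_contDiffOn.1 (hf.comp_contMDiffOn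
    (contMDiffOn_symm_of_mem_maximalAtlas (StructureGroupoid.subset_maximalAtlas _ he)))

theorem contMDiffAt_of_chartContDiff [IsManifold (𝓡 2) n M] {f : M → F}
    (he : e ∈ atlas E2 M) (hf : ChartContDiff e n f) (hp : p ∈ e.source) :
    ContMDiffAt (𝓡 2) 𝓘(ℝ, F) n f p := by
  have h1 : ContMDiffAt (𝓡 2) (𝓡 2) n e p :=
    contMDiffAt_of_mem_maximalAtlas (StructureGroupoid.subset_maximalAtlas _ he) hp
  have h2 : ContMDiffAt (𝓡 2) 𝓘(ℝ, F) n (f ∘ e.symm) (e p) := (hf.contDiffAt hp).contMDiffAt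
  refine (h2.comp p h1).congr_of_eventuallyEq ?_
  filter_upwards [e.open_source.mem_nhds hp] with m hm
  simp [e.left_inv hm]

theorem contMDiff_of_chartContDiff [IsManifold (𝓡 2) n M] {f : M → F}
    (hf : ∀ q : M, ChartContDiff (chartAt E2 q) n f) : ContMDiff (𝓡 2) 𝓘(ℝ, F) n f :=
  fun p => contMDiffAt_of_chartContDiff (chart_mem_atlas E2 p) (hf p) (mem_chart_source E2 p)

theorem contDiffOn_transition [IsManifold (𝓡 2) n M] (he : e ∈ atlas E2 M)
    (he' : e' ∈ atlas E2 M) : ContDiffOn ℝ n (e ∘ e'.symm) (e'.symm.trans e).source := by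
  refine contMDiffOn_iff_contDiffOn.1 (?_ : ContMDiffOn (𝓡 2) (𝓡 2) n _ _)
  have h1 := contMDiffOn_of_mem_maximalAtlas (I := 𝓡 2) (n := n)
    (StructureGroupoid.subset_maximalAtlas _ he)
  have h2 := contMDiffOn_symm_of_mem_maximalAtlas (I := 𝓡 2) (n := n)
    (StructureGroupoid.subset_maximalAtlas _ he')
  refine h1.comp (h2.mono ?_) ?_ <;> intro u hu <;> simp at hu ⊢ <;> tauto

theorem differentiableAt_transition [IsManifold (𝓡 2) 1 M] (he : e ∈ atlas E2 M)
    (he' : e' ∈ atlas E2 M) (hp : p ∈ e.source) (hp' : p ∈ e'.source) :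
    DifferentiableAt ℝ (e ∘ e'.symm) (e' p) := by
  refine ((contDiffOn_transition (n := 1) he he').contDiffAt
    ((e'.symm.trans e).open_source.mem_nhds ?_)).differentiableAt one_ne_zero
  simp [hp, e'.map_source hp', e'.left_inv hp']

/-- The Jacobian matrix `∂uᵃ/∂u'ⁱ` of the coordinates of `e` with respect to those of `e'`. -/
noncomputable def jac (e e' : OpenPartialHomeomorph M E2) (p : M) : Matrix (Fin 2) (Fin 2) ℝ :=
  Matrix.of fun a i => pd e' e i p a

/-- The transformation rule of partial derivatives under a change of charts. -/
theorem pd_change [IsManifold (𝓡 2) 1 M] (he : e ∈ atlas E2 M) (he' : e' ∈ atlas E2 M)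
    (hp : p ∈ e.source) (hp' : p ∈ e'.source) {f : M → F}
    (hf : DifferentiableAt ℝ (f ∘ e.symm) (e p)) (i : Fin 2) :
    pd e' f i p = ∑ a, jac e e' p a i • pd e f a p := by
  have h1 : f ∘ e'.symm =ᶠ[nhds (e' p)] (f ∘ e.symm) ∘ (e ∘ e'.symm) := by
    have : (e'.symm.trans e).source ∈ nhds (e' p) :=
      (e'.symm.trans e).open_source.mem_nhds (by simp [hp, e'.left_inv hp', e'.map_source hp'])
    filter_upwards [this] with u hu
    simp at hu
    simp [e.left_inv hu.2]
  have h2 : (e ∘ e'.symm) (e' p) = e p := by simp [e'.left_inv hp']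
  have h3 : ∀ v : E2, v = ∑ a, v a • EuclideanSpace.single a (1 : ℝ) := by
    intro v; ext b; fin_cases b <;> simp
  rw [pd, h1.fderiv_eq, fderiv_comp _ (by rwa [h2]) (differentiableAt_transition he he' hp hp'),
    h2, ContinuousLinearMap.comp_apply]
  conv_lhs => rw [h3 ((fderiv ℝ (e ∘ e'.symm) (e' p)) (EuclideanSpace.single i 1))]
  rw [map_sum]
  simp [jac, pd]

theorem jac_mul_jac [IsManifold (𝓡 2) 1 M] (he : e ∈ atlas E2 M) (he' : e' ∈ atlas E2 M)
    (hp : p ∈ e.source) (hp' : p ∈ e'.source) : jac e' e p * jac e e' p = 1 := by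
  ext b i
  have h1 := pd_change he he' hp hp' (differentiableAt_transition he' he hp' hp) i
  have h2 : pd e' e' i p = EuclideanSpace.single i (1 : ℝ) := by
    have : e' ∘ e'.symm =ᶠ[nhds (e' p)] id := by
      filter_upwards [e'.open_target.mem_nhds (e'.map_source hp')] with u hu
      simp [e'.right_inv hu]
    simp [pd, this.fderiv_eq]
  rw [h2] at h1
  have h3 := congrArg (fun v : E2 => v b) h1
  simp [Matrix.mul_apply, jac, Matrix.one_apply] at h3 ⊢
  rw [h3]; ring

theorem det_jac_ne_zero [IsManifold (𝓡 2) 1 M] (he : e ∈ atlas E2 M) (he' : e' ∈ atlas E2 M)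
    (hp : p ∈ e.source) (hp' : p ∈ e'.source) : (jac e e' p).det ≠ 0 := by
  intro h
  have := congrArg Matrix.det (jac_mul_jac he he' hp hp')
  simp [h] at this

omit [ChartedSpace E2 M] in
theorem det_fderiv_transition (e e' : OpenPartialHomeomorph M E2) (p : M) :
    (fderiv ℝ (e ∘ e'.symm) (e' p)).det = (jac e e' p).det := by
  rw [ContinuousLinearMap.det, ← LinearMap.det_toMatrix (EuclideanSpace.basisFun (Fin 2) ℝ).toBasis]
  congr 1

end ChartChange

/-! ### Orthogonality in three-space -/

section LinearAlgebra

variable {a : Fin 2 → E3} {ν : E3}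

theorem inner_eq_zero_of_mem_span {v : E3} (hνa : ∀ i, inner ℝ ν (a i) = 0)
    (hv : v ∈ Submodule.span ℝ (Set.range a)) : inner ℝ ν v = 0 := by
  induction hv using Submodule.span_induction with
  | mem u hu => obtain ⟨i, rfl⟩ := hu; exact hνa i
  | zero => simp
  | add u w _ _ h h' => simp [inner_add_right, h, h']
  | smul c u _ h => simp [inner_smul_right, h]

/-- In three-space, a vector orthogonal to a plane and to a normal of that plane vanishes. -/
theorem eq_zero_of_inner_eq_zero (ha : LinearIndependent ℝ a) (hν : ν ≠ 0)
    (hνa : ∀ i, inner ℝ ν (a i) = 0) {v : E3} (hv : inner ℝ ν v = 0)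
    (hva : ∀ i, inner ℝ v (a i) = 0) : v = 0 := by
  set K := Submodule.span ℝ (Set.range a)
  have h2 : Module.finrank ℝ K = 2 := by simpa using finrank_span_eq_card ha
  have h1 : Module.finrank ℝ Kᗮ = 1 := by
    have := K.finrank_add_finrank_orthogonal
    simp at this; omega
  have mem : ∀ w : E3, (∀ i, inner ℝ w (a i) = 0) → w ∈ Kᗮ := by
    intro w hw
    exact (K.mem_orthogonal' w).2 fun u hu => inner_eq_zero_of_mem_span hw hu
  obtain ⟨c, hc⟩ := (finrank_eq_one_iff_of_nonzero' (⟨ν, mem ν hνa⟩ : Kᗮ)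
    (by simpa [Subtype.ext_iff] using hν)).1 h1 ⟨v, mem v hva⟩
  have hc' : c • ν = v := congrArg Subtype.val hc
  rw [← hc', inner_smul_right] at hv
  rcases mul_eq_zero.1 hv with h | h
  · rw [← hc', h, zero_smul]
  · exact absurd (inner_self_eq_zero.1 h) hν

/-- A vector orthogonal to the tangent plane is a multiple of the unit normal. -/
theorem eq_inner_smul_normal (ha : LinearIndependent ℝ a) (hν : ‖ν‖ = 1)
    (hνa : ∀ i, inner ℝ ν (a i) = 0) {v : E3} (hva : ∀ i, inner ℝ v (a i) = 0) :
    v = inner ℝ ν v • ν := by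
  refine sub_eq_zero.1 (eq_zero_of_inner_eq_zero ha (by rintro rfl; simp at hν) hνa ?_ ?_)
  · simp [inner_sub_right, inner_smul_right, hν]
  · intro i; simp [inner_sub_left, inner_smul_left, hνa, hva]

theorem det_gram_pos (ha : LinearIndependent ℝ a) :
    0 < inner ℝ (a 0) (a 0) * inner ℝ (a 1) (a 1) - inner ℝ (a 0) (a 1) * inner ℝ (a 1) (a 0) := by
  have := (Matrix.posDef_gram_iff_linearIndependent.2 ha).det_pos
  simpa [Matrix.det_fin_two, Matrix.gram] using this

/-- The components of a tangent vector with respect to a basis of the tangent plane, by Cramer's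
rule. -/
theorem eq_combination_of_inner_normal_eq_zero (ha : LinearIndependent ℝ a) (hν : ‖ν‖ = 1)
    (hνa : ∀ i, inner ℝ ν (a i) = 0) {v : E3} (hv : inner ℝ ν v = 0) :
    v = ((inner ℝ v (a 0) * inner ℝ (a 1) (a 1) - inner ℝ v (a 1) * inner ℝ (a 0) (a 1)) /
        (inner ℝ (a 0) (a 0) * inner ℝ (a 1) (a 1) - inner ℝ (a 0) (a 1) * inner ℝ (a 1) (a 0))) •
          a 0 +
      ((inner ℝ v (a 1) * inner ℝ (a 0) (a 0) - inner ℝ v (a 0) * inner ℝ (a 0) (a 1)) /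
        (inner ℝ (a 0) (a 0) * inner ℝ (a 1) (a 1) - inner ℝ (a 0) (a 1) * inner ℝ (a 1) (a 0))) •
          a 1 := by
  have hd := (det_gram_pos ha).ne'
  refine sub_eq_zero.1 (eq_zero_of_inner_eq_zero ha (by rintro rfl; simp at hν) hνa ?_ ?_)
  · simp [inner_sub_right, inner_add_right, inner_smul_right, hνa, hv]
  · have hs := real_inner_comm (a 0) (a 1)
    rw [hs] at hd ⊢
    generalize hD : inner ℝ (a 0) (a 0) * inner ℝ (a 1) (a 1) -
      inner ℝ (a 0) (a 1) * inner ℝ (a 0) (a 1) = D at hd ⊢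
    intro i
    fin_cases i <;>
    · simp only [inner_sub_left, inner_add_left, inner_smul_left, Fin.zero_eta, Fin.mk_one,
        conj_trivial, hs]
      field_simp
      rw [← hD]
      ring

end LinearAlgebra

/-! ### The unit normal and the fundamental forms -/

section Surface

variable {M : Type*} [TopologicalSpace M] [ChartedSpace E2 M]
  {e e' : OpenPartialHomeomorph M E2} {r k : WithTop ℕ∞} {p : M} {x ξ : M → E3}

/-- The immersion condition in an arbitrary chart of the atlas. -/
theorem linearIndependent_pd [IsManifold (𝓡 2) 1 M] (hx : IsPosCurvedSurface r x ξ) (hr : 1 ≤ r)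
    (he : e ∈ atlas E2 M) (hp : p ∈ e.source) : LinearIndependent ℝ fun i => pd e x i p := by
  have hd : e.MDifferentiable (𝓡 2) (𝓡 2) := mdifferentiable_of_mem_atlas he
  have hxd : MDifferentiableAt (𝓡 2) 𝓘(ℝ, E3) x (e.symm (e p)) :=
    (hx.contMDiff.mdifferentiable (by rintro rfl; simp at hr)) _
  have h2 : MDifferentiableAt (𝓡 2) (𝓡 2) e.symm (e p) :=
    hd.mdifferentiableAt_symm (e.map_source hp)
  have h1 : fderiv ℝ (x ∘ e.symm) (e p) =
      (mfderiv (𝓡 2) 𝓘(ℝ, E3) x (e.symm (e p))).comp (mfderiv (𝓡 2) (𝓡 2) e.symm (e p)) := by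
    rw [← mfderiv_eq_fderiv]
    exact mfderiv_comp _ hxd h2
  have h3 : Function.Injective (fderiv ℝ (x ∘ e.symm) (e p)) := by
    rw [h1]
    exact (hx.immersion _).comp (hd.symm.mfderiv_injective (e.map_source hp))
  have h4 := (EuclideanSpace.basisFun (Fin 2) ℝ).toBasis.linearIndependent.map'
    (fderiv ℝ (x ∘ e.symm) (e p)).toLinearMap (LinearMap.ker_eq_bot.2 h3)
  have h5 : (fun i => pd e x i p) = (fderiv ℝ (x ∘ e.symm) (e p)).toLinearMap ∘
      (EuclideanSpace.basisFun (Fin 2) ℝ).toBasis := by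
    funext i
    simp [pd]
  rw [h5]
  exact h4

theorem inner_normal_pd [IsManifold (𝓡 2) 1 M] (hx : IsPosCurvedSurface r x ξ) (hr : 1 ≤ r)
    (he : e ∈ atlas E2 M) (hp : p ∈ e.source) (i : Fin 2) :
    inner ℝ (ξ p) (pd e x i p) = 0 := by
  have h1 : ContMDiff (𝓡 2) 𝓘(ℝ, E3) 1 x := hx.contMDiff.of_le hr
  rw [pd_change (chart_mem_atlas E2 p) he (mem_chart_source E2 p) hp
    ((chartContDiff_of_contMDiff h1 (chart_mem_atlas E2 p)).differentiableAt le_rfl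
      (mem_chart_source E2 p)) i]
  simp [inner_add_right, inner_smul_right, hx.normal_orthogonal]

theorem IsPosCurvedSurface.chartContDiff [IsManifold (𝓡 2) r M] (hx : IsPosCurvedSurface r x ξ)
    (he : e ∈ atlas E2 M) : ChartContDiff e r x :=
  chartContDiff_of_contMDiff hx.contMDiff he

/-- The unit normal is one derivative less regular than the immersion. Near a point it is the
normalization of the component normal to the surface of a constant vector. -/
theorem IsPosCurvedSurface.chartContDiff_normal [IsManifold (𝓡 2) 1 M] [IsManifold (𝓡 2) r M]
    (hx : IsPosCurvedSurface r x ξ) (hk : k + 1 ≤ r) (he : e ∈ atlas E2 M) :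
    ChartContDiff e k ξ := by
  have hr : 1 ≤ r := le_trans (by simp) hk
  have hX : ∀ i, ChartContDiff e k (pd e x i) := (hx.chartContDiff he).pd hk
  intro u hu
  refine ContDiffAt.contDiffWithinAt ?_
  set ν := ξ (e.symm u) with hν
  let D : M → ℝ := fun m => inner ℝ (pd e x 0 m) (pd e x 0 m) * inner ℝ (pd e x 1 m) (pd e x 1 m) -
    inner ℝ (pd e x 0 m) (pd e x 1 m) * inner ℝ (pd e x 1 m) (pd e x 0 m)
  let A : M → ℝ := fun m => inner ℝ ν (pd e x 0 m) * inner ℝ (pd e x 1 m) (pd e x 1 m) -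
    inner ℝ ν (pd e x 1 m) * inner ℝ (pd e x 0 m) (pd e x 1 m)
  let B : M → ℝ := fun m => inner ℝ ν (pd e x 1 m) * inner ℝ (pd e x 0 m) (pd e x 0 m) -
    inner ℝ ν (pd e x 0 m) * inner ℝ (pd e x 0 m) (pd e x 1 m)
  let N : M → E3 := fun m => D m • ν - (A m • pd e x 0 m + B m • pd e x 1 m)
  have hc : ChartContDiff e k fun _ => ν := .const ν
  have hN : ChartContDiff e k N := by
    refine .sub (.smul ?_ hc) (.add (.smul ?_ (hX 0)) (.smul ?_ (hX 1)))
    · exact .sub (.mul (.inner (hX 0) (hX 0)) (.inner (hX 1) (hX 1)))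
        (.mul (.inner (hX 0) (hX 1)) (.inner (hX 1) (hX 0)))
    · exact .sub (.mul (.inner hc (hX 0)) (.inner (hX 1) (hX 1)))
        (.mul (.inner hc (hX 1)) (.inner (hX 0) (hX 1)))
    · exact .sub (.mul (.inner hc (hX 1)) (.inner (hX 0) (hX 0)))
        (.mul (.inner hc (hX 0)) (.inner (hX 0) (hX 1)))
  -- `N` is `D` times the orthogonal projection of `ν` to the normal line.
  have hD : ∀ m ∈ e.source, 0 < D m := fun m hm => det_gram_pos (linearIndependent_pd hx hr he hm)
  have hNξ : ∀ m ∈ e.source, N m = (D m * inner ℝ (ξ m) ν) • ξ m := by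
    intro m hm
    have hν' := inner_normal_pd hx hr he hm
    rw [eq_inner_smul_normal (linearIndependent_pd hx hr he hm) (hx.norm_normal m) hν' (v := N m)]
    · simp [N, inner_sub_right, inner_add_right, inner_smul_right, hν']
    · have hs := real_inner_comm (pd e x 0 m) (pd e x 1 m)
      intro i
      fin_cases i <;>
      · simp only [N, A, B, D, inner_sub_left, inner_add_left, inner_smul_left, Fin.zero_eta,
          Fin.mk_one, conj_trivial, hs]
        ring
  have hξc : ContinuousAt (fun w => inner ℝ (ξ (e.symm w)) ν) u :=
    (hx.continuous_normal.continuousAt.comp (e.symm.continuousAt hu)).inner continuousAt_const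
  have hpos : ∀ᶠ w in nhds u, 0 < inner ℝ (ξ (e.symm w)) ν :=
    hξc.eventually (lt_mem_nhds (by simp [ν, hx.norm_normal]))
  have heq : ξ ∘ e.symm =ᶠ[nhds u] fun w => ‖(N ∘ e.symm) w‖⁻¹ • (N ∘ e.symm) w := by
    filter_upwards [hpos, e.open_target.mem_nhds hu] with w hw hwt
    have h1 := hNξ _ (e.map_target hwt)
    have h2 : 0 < D (e.symm w) * inner ℝ (ξ (e.symm w)) ν := mul_pos (hD _ (e.map_target hwt)) hw
    simp only [Function.comp_apply, h1, norm_smul, hx.norm_normal, mul_one, Real.norm_eq_abs,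
      abs_of_pos h2, smul_smul, inv_mul_cancel₀ h2.ne', one_smul]
  have hNu : ContDiffAt ℝ k (N ∘ e.symm) u := ContDiffOn.contDiffAt hN (e.open_target.mem_nhds hu)
  have hN0 : (N ∘ e.symm) u ≠ 0 := by
    rw [Function.comp_apply, hNξ _ (e.map_target hu)]
    refine smul_ne_zero (mul_pos (hD _ (e.map_target hu)) hpos.self_of_nhds).ne' ?_
    intro h
    simpa [h] using hx.norm_normal (e.symm u)
  exact (((hNu.norm ℝ hN0).inv (norm_ne_zero_iff.2 hN0)).smul hNu).congr_of_eventuallyEq heq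

section Tensors

variable [IsManifold (𝓡 2) 1 M] [IsManifold (𝓡 2) r M]

/-- The second fundamental form in terms of the first derivatives of the normal. -/
theorem secondForm_eq_neg (hx : IsPosCurvedSurface r x ξ) (hr : 2 ≤ r)
    (he : e ∈ atlas E2 M) (hp : p ∈ e.source) (i j : Fin 2) :
    secondForm e x ξ p i j = -inner ℝ (pd e ξ j p) (pd e x i p) := by
  have hr' : (1 : WithTop ℕ∞) + 1 ≤ r := by rwa [one_add_one_eq_two]
  have h1 := pd_inner ((hx.chartContDiff_normal hr' he).differentiableAt le_rfl hp)
    ((((hx.chartContDiff he).pd hr') i).differentiableAt le_rfl hp) hp j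
  rw [pd_congr (g := fun _ => (0 : ℝ)) (fun m hm => inner_normal_pd hx
    (le_trans (by simp) hr') he hm i) hp, pd_const] at h1
  simp only [secondForm, Matrix.of_apply]
  linarith

omit [IsManifold (𝓡 2) 1 M] in
theorem secondForm_symm (hx : IsPosCurvedSurface r x ξ) (hr : 2 ≤ r)
    (he : e ∈ atlas E2 M) (hp : p ∈ e.source) (i j : Fin 2) :
    secondForm e x ξ p i j = secondForm e x ξ p j i := by
  simp only [secondForm, Matrix.of_apply]
  rw [pd_pd_comm ((hx.chartContDiff he).of_le hr) hp]

theorem inner_pd_change (he : e ∈ atlas E2 M) (he' : e' ∈ atlas E2 M)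
    (hp : p ∈ e.source) (hp' : p ∈ e'.source) {f g : M → E3}
    (hf : DifferentiableAt ℝ (f ∘ e.symm) (e p)) (hg : DifferentiableAt ℝ (g ∘ e.symm) (e p)) :
    (Matrix.of fun i j => inner ℝ (pd e' f i p) (pd e' g j p)) =
      (jac e e' p).transpose * (Matrix.of fun i j => inner ℝ (pd e f i p) (pd e g j p)) *
        jac e e' p := by
  ext i j
  simp only [Matrix.of_apply, pd_change he he' hp hp' hf, pd_change he he' hp hp' hg,
    Matrix.mul_apply, Fin.sum_univ_two, inner_add_left, inner_add_right, inner_smul_left,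
    inner_smul_right, Matrix.transpose_apply, conj_trivial]
  ring

theorem firstForm_change (hx : IsPosCurvedSurface r x ξ) (hr : 1 ≤ r)
    (he : e ∈ atlas E2 M) (he' : e' ∈ atlas E2 M) (hp : p ∈ e.source) (hp' : p ∈ e'.source) :
    firstForm e' x p = (jac e e' p).transpose * firstForm e x p * jac e e' p :=
  have h := (hx.chartContDiff he).differentiableAt hr hp
  inner_pd_change he he' hp hp' h h

/-- The second fundamental form is a tensor: written as `-⟨∂ⱼ ξ, ∂ᵢ x⟩` it contains first
derivatives only, so second derivatives of the change of coordinates do not enter. -/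
theorem secondForm_change (hx : IsPosCurvedSurface r x ξ) (hr : 2 ≤ r)
    (he : e ∈ atlas E2 M) (he' : e' ∈ atlas E2 M) (hp : p ∈ e.source) (hp' : p ∈ e'.source) :
    secondForm e' x ξ p = (jac e e' p).transpose * secondForm e x ξ p * jac e e' p := by
  have key : ∀ e ∈ atlas E2 M, p ∈ e.source → secondForm e x ξ p =
      -(Matrix.of fun i j => inner ℝ (pd e x i p) (pd e ξ j p)) := by
    intro e he hp
    ext i j
    rw [secondForm_eq_neg hx hr he hp, real_inner_comm]
    rfl
  have hr' : (1 : WithTop ℕ∞) + 1 ≤ r := by rwa [one_add_one_eq_two]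
  rw [key e he hp, key e' he' hp', inner_pd_change he he' hp hp'
    ((hx.chartContDiff he).differentiableAt (le_trans (by simp) hr') hp)
    ((hx.chartContDiff_normal hr' he).differentiableAt le_rfl hp)]
  simp only [Matrix.mul_neg, Matrix.neg_mul]

end Tensors

end Surface

/-! ### Gaussian curvature, the equiaffine normalization and the relative mean curvature -/

section Curvature

theorem one_add_two : (1 : WithTop ℕ∞) + 2 = 3 := by norm_num

variable {M : Type*} [TopologicalSpace M] [ChartedSpace E2 M]
  {e e' : OpenPartialHomeomorph M E2} {r k : WithTop ℕ∞} {p : M} {x ξ : M → E3}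
  [IsManifold (𝓡 2) 1 M] [IsManifold (𝓡 2) r M]

omit [IsManifold (𝓡 2) r M] in
theorem det_firstForm_pos (hx : IsPosCurvedSurface r x ξ) (hr : 1 ≤ r)
    (he : e ∈ atlas E2 M) (hp : p ∈ e.source) : 0 < (firstForm e x p).det := by
  rw [Matrix.det_fin_two]
  exact det_gram_pos (linearIndependent_pd hx hr he hp)

/-- The Gaussian curvature may be computed in any chart of the atlas. -/
theorem gaussCurv_eq (hx : IsPosCurvedSurface r x ξ) (hr : 2 ≤ r)
    (he : e ∈ atlas E2 M) (hp : p ∈ e.source) :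
    gaussCurv x ξ p = (secondForm e x ξ p).det / (firstForm e x p).det := by
  have h1 : (1 : WithTop ℕ∞) ≤ r := le_trans (by norm_num) hr
  have hc := chart_mem_atlas E2 p
  have hpc := mem_chart_source E2 p
  have hJ := det_jac_ne_zero he hc hp hpc
  have hg := (det_firstForm_pos hx h1 he hp).ne'
  rw [gaussCurv, secondForm_change hx hr he hc hp hpc, firstForm_change hx h1 he hc hp hpc]
  simp only [Matrix.det_mul, Matrix.det_transpose]
  field_simp

theorem det_secondForm_pos (hx : IsPosCurvedSurface r x ξ) (hr : 2 ≤ r)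
    (he : e ∈ atlas E2 M) (hp : p ∈ e.source) : 0 < (secondForm e x ξ p).det := by
  have h1 := hx.curv_pos p
  rw [gaussCurv_eq hx hr he hp] at h1
  exact (div_pos_iff_of_pos_right (det_firstForm_pos hx (le_trans (by norm_num) hr) he hp)).1 h1

theorem chartContDiff_secondForm (hx : IsPosCurvedSurface r x ξ) (hk : k + 2 ≤ r)
    (he : e ∈ atlas E2 M) (i j : Fin 2) : ChartContDiff e k fun m => secondForm e x ξ m i j := by
  have h1 : k + 1 + 1 ≤ r := by rwa [add_assoc, one_add_one_eq_two]
  exact .inner (hx.chartContDiff_normal (le_trans le_self_add h1) he)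
    (((hx.chartContDiff he).pd h1 i).pd le_rfl j)

omit [IsManifold (𝓡 2) 1 M] in
theorem chartContDiff_firstForm (hx : IsPosCurvedSurface r x ξ) (hk : k + 1 ≤ r)
    (he : e ∈ atlas E2 M) (i j : Fin 2) : ChartContDiff e k fun m => firstForm e x m i j :=
  .inner ((hx.chartContDiff he).pd hk i) ((hx.chartContDiff he).pd hk j)

omit [ChartedSpace E2 M] [IsManifold (𝓡 2) 1 M] in
theorem chartContDiff_det {A : M → Matrix (Fin 2) (Fin 2) ℝ}
    (hA : ∀ i j, ChartContDiff e k fun m => A m i j) : ChartContDiff e k fun m => (A m).det := by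
  simp only [Matrix.det_fin_two]
  exact .sub (.mul (hA 0 0) (hA 1 1)) (.mul (hA 0 1) (hA 1 0))

omit [ChartedSpace E2 M] [IsManifold (𝓡 2) 1 M] [IsManifold (𝓡 2) r M] in
theorem chartContDiff_inv {A : M → Matrix (Fin 2) (Fin 2) ℝ}
    (hA : ∀ i j, ChartContDiff e k fun m => A m i j) (hd : ∀ m ∈ e.source, (A m).det ≠ 0)
    (i j : Fin 2) : ChartContDiff e k fun m => (A m)⁻¹ i j := by
  have h1 : ∀ i j, ChartContDiff e k fun m => (A m).adjugate i j := by
    intro i j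
    simp only [Matrix.adjugate_fin_two]
    fin_cases i <;> fin_cases j <;> simp
    · exact hA 1 1
    · exact ContDiffOn.neg (hA 0 1)
    · exact ContDiffOn.neg (hA 1 0)
    · exact hA 0 0
  refine ((h1 i j).div (chartContDiff_det hA) hd).congr fun m _ => ?_
  simp [Matrix.inv_def, Ring.inverse_eq_inv', div_eq_inv_mul]

theorem chartContDiff_gaussCurv (hx : IsPosCurvedSurface r x ξ) (hk : k + 2 ≤ r)
    (he : e ∈ atlas E2 M) : ChartContDiff e k (gaussCurv x ξ) := by
  have h2 : 2 ≤ r := le_trans le_add_self hk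
  have h1 : 1 ≤ r := le_trans (by norm_num) h2
  refine ChartContDiff.congr (.div (chartContDiff_det (chartContDiff_secondForm hx hk he))
    (chartContDiff_det (chartContDiff_firstForm hx (le_trans (by gcongr; norm_num) hk) he))
    fun m hm => (det_firstForm_pos hx h1 he hm).ne') fun m hm => gaussCurv_eq hx h2 he hm

omit [IsManifold (𝓡 2) 1 M] [IsManifold (𝓡 2) r M] in
theorem qAff_pos (hx : IsPosCurvedSurface r x ξ) (p : M) : 0 < qAff x ξ p :=
  Real.rpow_pos_of_pos (abs_pos.2 (hx.curv_pos p).ne') _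

theorem chartContDiff_qAff (hx : IsPosCurvedSurface r x ξ) (hk : k + 2 ≤ r)
    (he : e ∈ atlas E2 M) : ChartContDiff e k (qAff x ξ) := by
  have h1 : ChartContDiff e k fun m => gaussCurv x ξ m ^ ((1 : ℝ) / 4) :=
    ContDiffOn.rpow_const_of_ne (chartContDiff_gaussCurv hx hk he) fun u _ => (hx.curv_pos _).ne'
  exact h1.congr fun m _ => by rw [qAff, abs_of_pos (hx.curv_pos m)]

/-- The derivatives of the unit normal span the tangent plane. -/
theorem eq_zero_of_inner_pd_normal (hx : IsPosCurvedSurface r x ξ) (hr : 2 ≤ r)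
    (he : e ∈ atlas E2 M) (hp : p ∈ e.source) {v : E3} (hv : inner ℝ (ξ p) v = 0)
    (hvi : ∀ i, inner ℝ (pd e ξ i p) v = 0) : v = 0 := by
  have h1 : (1 : WithTop ℕ∞) ≤ r := le_trans (by norm_num) hr
  have hdec := eq_combination_of_inner_normal_eq_zero (linearIndependent_pd hx h1 he hp)
    (hx.norm_normal p) (inner_normal_pd hx h1 he hp) hv
  set a := (inner ℝ v (pd e x 0 p) * inner ℝ (pd e x 1 p) (pd e x 1 p) - _) / _
  set b := (inner ℝ v (pd e x 1 p) * inner ℝ (pd e x 0 p) (pd e x 0 p) - _) / _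
  have h2 : ∀ i, secondForm e x ξ p 0 i * a + secondForm e x ξ p 1 i * b = 0 := by
    intro i
    have := hvi i
    rw [hdec, inner_add_right, inner_smul_right, inner_smul_right] at this
    rw [secondForm_eq_neg hx hr he hp, secondForm_eq_neg hx hr he hp]
    linarith
  have hd := (det_secondForm_pos hx hr he hp).ne'
  rw [Matrix.det_fin_two] at hd
  have ha : a = 0 := by
    refine (mul_eq_zero.1 ?_).resolve_left hd
    linear_combination secondForm e x ξ p 1 1 * h2 0 - secondForm e x ξ p 1 0 * h2 1
  have hb : b = 0 := by
    refine (mul_eq_zero.1 ?_).resolve_left hd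
    linear_combination secondForm e x ξ p 0 0 * h2 1 - secondForm e x ξ p 0 1 * h2 0
  rw [hdec, ha, hb, zero_smul, zero_smul, add_zero]

/-- The equiaffine normalization, written in the chart `e`. -/
noncomputable def chartYAff (e : OpenPartialHomeomorph M E2) (x ξ : M → E3) (p : M) : E3 :=
  qAff x ξ p • ξ p -
    ∑ i, ∑ j, ((secondForm e x ξ p)⁻¹ i j * pd e (qAff x ξ) i p) • pd e x j p

omit [IsManifold (𝓡 2) r M] in
theorem inner_normal_chartYAff (hx : IsPosCurvedSurface r x ξ) (hr : 2 ≤ r)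
    (he : e ∈ atlas E2 M) (hp : p ∈ e.source) :
    inner ℝ (ξ p) (chartYAff e x ξ p) = qAff x ξ p := by
  have := inner_normal_pd hx (le_trans (by norm_num) hr) he hp
  simp [chartYAff, inner_sub_right, inner_add_right, inner_smul_right, this, hx.norm_normal]

theorem inner_pd_normal_normal (hx : IsPosCurvedSurface r x ξ) (hr : 2 ≤ r)
    (he : e ∈ atlas E2 M) (hp : p ∈ e.source) (i : Fin 2) : inner ℝ (pd e ξ i p) (ξ p) = 0 := by
  have hr' : (1 : WithTop ℕ∞) + 1 ≤ r := by rwa [one_add_one_eq_two]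
  have h := (hx.chartContDiff_normal hr' he).differentiableAt le_rfl hp
  have h1 := pd_inner h h hp i
  rw [pd_congr (g := fun _ => (1 : ℝ)) (fun m hm => by simp [hx.norm_normal]) hp, pd_const,
    real_inner_comm (pd e ξ i p)] at h1
  linarith

theorem inner_pd_normal_chartYAff (hx : IsPosCurvedSurface r x ξ) (hr : 2 ≤ r)
    (he : e ∈ atlas E2 M) (hp : p ∈ e.source) (i : Fin 2) :
    inner ℝ (pd e ξ i p) (chartYAff e x ξ p) = pd e (qAff x ξ) i p := by
  have h1 : ∀ j, inner ℝ (pd e ξ i p) (pd e x j p) = -secondForm e x ξ p j i := fun j => by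
    rw [secondForm_eq_neg hx hr he hp, neg_neg]
  have h2 : ((secondForm e x ξ p)⁻¹ * secondForm e x ξ p) = 1 :=
    Matrix.nonsing_inv_mul _ (det_secondForm_pos hx hr he hp).ne'.isUnit
  have h3 : ∀ a, (secondForm e x ξ p)⁻¹ a 0 * secondForm e x ξ p 0 i +
      (secondForm e x ξ p)⁻¹ a 1 * secondForm e x ξ p 1 i = if a = i then 1 else 0 := by
    intro a
    simpa [Matrix.mul_apply, Matrix.one_apply] using congrFun (congrFun h2 a) i
  simp only [chartYAff, inner_sub_right, inner_smul_right, inner_add_right, Fin.sum_univ_two, h1,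
    inner_pd_normal_normal hx hr he hp]
  have h30 := h3 0
  have h31 := h3 1
  fin_cases i <;> simp at h30 h31 ⊢
  · linear_combination pd e (qAff x ξ) 0 p * h30 + pd e (qAff x ξ) 1 p * h31
  · linear_combination pd e (qAff x ξ) 0 p * h30 + pd e (qAff x ξ) 1 p * h31

/-- The equiaffine normalization satisfies `⟨∂ᵢ ξ, y_aff⟩ = ∂ᵢ q_aff` in every chart. -/
theorem inner_pd_normal_yAff (hx : IsPosCurvedSurface r x ξ) (hr : 3 ≤ r)
    (he : e ∈ atlas E2 M) (hp : p ∈ e.source) (i : Fin 2) :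
    inner ℝ (pd e ξ i p) (yAff x ξ p) = pd e (qAff x ξ) i p := by
  have hc := chart_mem_atlas E2 p
  have hpc := mem_chart_source E2 p
  have hr2 : (2 : WithTop ℕ∞) ≤ r := le_trans (by norm_num) hr
  have hr1 : (1 : WithTop ℕ∞) + 1 ≤ r := by rwa [one_add_one_eq_two]
  have hr3 : (1 : WithTop ℕ∞) + 2 ≤ r := by rwa [one_add_two]
  rw [pd_change hc he hpc hp ((hx.chartContDiff_normal hr1 hc).differentiableAt le_rfl hpc),
    pd_change hc he hpc hp ((chartContDiff_qAff hx hr3 hc).differentiableAt le_rfl hpc)]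
  simp only [sum_inner, inner_smul_left, smul_eq_mul, conj_trivial]
  refine Finset.sum_congr rfl fun a _ => ?_
  rw [← inner_pd_normal_chartYAff hx hr2 hc hpc a]
  rfl

/-- The equiaffine normalization does not depend on the chart: the values of `⟨ξ, v⟩` and
`⟨∂ᵢ ξ, v⟩` determine a vector `v`. -/
theorem yAff_eq_chartYAff (hx : IsPosCurvedSurface r x ξ) (hr : 3 ≤ r)
    (he : e ∈ atlas E2 M) (hp : p ∈ e.source) : yAff x ξ p = chartYAff e x ξ p := by
  have hr2 : (2 : WithTop ℕ∞) ≤ r := le_trans (by norm_num) hr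
  refine sub_eq_zero.1 (eq_zero_of_inner_pd_normal hx hr2 he hp ?_ fun i => ?_)
  · rw [inner_sub_right, inner_normal_chartYAff hx hr2 he hp, sub_eq_zero]
    exact support_yAff hx p
  · rw [inner_sub_right, inner_pd_normal_chartYAff hx hr2 he hp, inner_pd_normal_yAff hx hr he hp,
      sub_self]

theorem chartContDiff_yAff (hx : IsPosCurvedSurface r x ξ) (hk : k + 3 ≤ r)
    (he : e ∈ atlas E2 M) : ChartContDiff e k (yAff x ξ) := by
  have hr : (3 : WithTop ℕ∞) ≤ r := le_trans le_add_self hk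
  have hr2 : (2 : WithTop ℕ∞) ≤ r := le_trans (by norm_num) hr
  have h1 : k + 1 ≤ r := le_trans (by gcongr; norm_num) hk
  have h2 : k + 2 ≤ r := le_trans (by gcongr; norm_num) hk
  have h3 : k + 1 + 2 ≤ r := by rwa [add_assoc, one_add_two]
  refine ChartContDiff.congr ?_ fun m hm => yAff_eq_chartYAff hx hr he hm
  simp only [chartYAff, Fin.sum_univ_two]
  have hT : ∀ i j, ChartContDiff e k fun m =>
      ((secondForm e x ξ m)⁻¹ i j * pd e (qAff x ξ) i m) • pd e x j m := fun i j =>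
    .smul (.mul (chartContDiff_inv (chartContDiff_secondForm hx h2 he)
      (fun m hm => (det_secondForm_pos hx hr2 he hm).ne') i j)
      ((chartContDiff_qAff hx h3 he).pd le_rfl i)) ((hx.chartContDiff he).pd h1 j)
  exact .sub (.smul (chartContDiff_qAff hx h2 he) (hx.chartContDiff_normal h1 he))
    (.add (.add (hT 0 0) (hT 0 1)) (.add (hT 1 0) (hT 1 1)))

omit [ChartedSpace E2 M] [IsManifold (𝓡 2) 1 M] in
theorem trace_shapeCoeff (e : OpenPartialHomeomorph M E2) (x y : M → E3) (p : M) :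
    (shapeCoeff e x y p).trace = -(inner ℝ (pd e y 0 p) (pd e x 0 p) * firstForm e x p 1 1 -
      inner ℝ (pd e y 0 p) (pd e x 1 p) * firstForm e x p 1 0 -
      inner ℝ (pd e y 1 p) (pd e x 0 p) * firstForm e x p 0 1 +
      inner ℝ (pd e y 1 p) (pd e x 1 p) * firstForm e x p 0 0) / (firstForm e x p).det := by
  simp [shapeCoeff, Matrix.inv_def, Ring.inverse_eq_inv', Matrix.adjugate_fin_two,
    Matrix.trace_fin_two, Matrix.mul_apply, div_eq_inv_mul]
  ring

/-- The relative mean curvature may be computed in any chart of the atlas. -/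
theorem relMeanCurv_eq (hx : IsPosCurvedSurface r x ξ) (hr : 1 ≤ r)
    (he : e ∈ atlas E2 M) (hp : p ∈ e.source) {y : M → E3} (hy : ChartContDiff e 1 y) :
    relMeanCurv x y p = (1 / 2) * (shapeCoeff e x y p).trace := by
  have hc := chart_mem_atlas E2 p
  have hpc := mem_chart_source E2 p
  have hJ : IsUnit (jac e (chartAt E2 p) p).det := (det_jac_ne_zero he hc hp hpc).isUnit
  rw [relMeanCurv, shapeCoeff, shapeCoeff, firstForm_change hx hr he hc hp hpc,
    inner_pd_change he hc hp hpc (hy.differentiableAt le_rfl hp)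
      ((hx.chartContDiff he).differentiableAt hr hp)]
  rw [Matrix.trace_neg, Matrix.trace_neg]
  congr 2
  set J := jac e (chartAt E2 p) p
  rw [Matrix.mul_inv_rev, Matrix.mul_inv_rev, Matrix.mul_assoc, ← Matrix.mul_assoc J,
    Matrix.mul_nonsing_inv _ hJ, Matrix.one_mul, Matrix.mul_assoc, Matrix.trace_mul_comm,
    Matrix.mul_assoc, Matrix.mul_assoc, Matrix.nonsing_inv_mul _ (by rwa [Matrix.det_transpose]),
    Matrix.mul_one]

theorem chartContDiff_relMeanCurv (hx : IsPosCurvedSurface r x ξ) (hr : 1 ≤ r)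
    (he : e ∈ atlas E2 M) {y : M → E3} (hy : ChartContDiff e 1 y) :
    ChartContDiff e 0 (relMeanCurv x y) := by
  have hX := fun i => (hx.chartContDiff he).pd (k := 0) (by simpa using hr) i
  have hY := fun i => hy.pd (k := 0) (by simp) i
  have hG := chartContDiff_firstForm (k := 0) hx (by simpa using hr) he
  refine ChartContDiff.congr ?_ fun m hm => relMeanCurv_eq hx hr he hm hy
  simp only [trace_shapeCoeff]
  refine .mul (.const _) (.div (ContDiffOn.neg (ChartContDiff.add (.sub (.sub
    (.mul (.inner (hY 0) (hX 0)) (hG 1 1)) (.mul (.inner (hY 0) (hX 1)) (hG 1 0)))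
    (.mul (.inner (hY 1) (hX 0)) (hG 0 1))) (.mul (.inner (hY 1) (hX 1)) (hG 0 0))))
    (chartContDiff_det hG) fun m hm => (det_firstForm_pos hx hr he hm).ne')

end Curvature

/-! ### The area measure of the second fundamental form -/

section Area

variable {M : Type*} [TopologicalSpace M] [MeasurableSpace M] [BorelSpace M]
  {e e' : OpenPartialHomeomorph M E2} {r : WithTop ℕ∞} {p : M} {x ξ : M → E3}

/-- `Measure.map` takes the value zero on maps that are not almost everywhere measurable, so this is
needed for `chartAreaII` to be meaningful. -/
theorem aemeasurable_symm (e : OpenPartialHomeomorph M E2) (f : E2 → ENNReal) :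
    AEMeasurable e.symm (((volume : Measure E2).restrict e.target).withDensity f) :=
  (e.symm.continuousOn.aemeasurable e.open_target.measurableSet).mono_ac
    (withDensity_absolutelyContinuous _ _)

theorem chartAreaII_apply {A : Set M} (hA : MeasurableSet A) :
    chartAreaII x ξ e A = ∫⁻ u in e.symm ⁻¹' A ∩ e.target,
      ENNReal.ofReal √|(secondForm e x ξ (e.symm u)).det| := by
  rw [chartAreaII, Measure.map_apply_of_aemeasurable (aemeasurable_symm e _) hA,
    withDensity_apply', Measure.restrict_restrict' e.open_target.measurableSet]

theorem measurableSet_symm_preimage (e : OpenPartialHomeomorph M E2) {A : Set M}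
    (hA : MeasurableSet A) : MeasurableSet (e.symm ⁻¹' A ∩ e.target) := by
  have h := (continuousOn_iff_continuous_domRestrict.1 e.symm.continuousOn).measurable hA
  have h2 := MeasurableSet.subtype_image e.open_target.measurableSet h
  convert h2 using 1
  ext u
  simp [and_comm]

theorem chartAreaII_inter_source {A : Set M} (hA : MeasurableSet A) :
    chartAreaII x ξ e (A ∩ e.source) = chartAreaII x ξ e A := by
  rw [chartAreaII_apply hA, chartAreaII_apply (hA.inter e.open_source.measurableSet)]
  congr 2
  ext u
  simp only [Set.mem_inter_iff, Set.mem_preimage]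
  exact ⟨fun h => ⟨h.1.1, h.2⟩, fun h => ⟨⟨h.1, e.map_target h.2⟩, h.2⟩⟩

variable [ChartedSpace E2 M] [IsManifold (𝓡 2) 1 M] [IsManifold (𝓡 2) r M]

/-- The area measures of two charts agree on the overlap of the charts. -/
theorem chartAreaII_inter_eq (hx : IsPosCurvedSurface r x ξ) (hr : 2 ≤ r)
    (he : e ∈ atlas E2 M) (he' : e' ∈ atlas E2 M) {A : Set M} (hA : MeasurableSet A) :
    chartAreaII x ξ e' (A ∩ e.source) = chartAreaII x ξ e (A ∩ e'.source) := by
  have hA1 := hA.inter e.open_source.measurableSet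
  have hA2 := hA.inter e'.open_source.measurableSet
  rw [chartAreaII_apply hA1, chartAreaII_apply hA2]
  set S := e'.symm ⁻¹' (A ∩ e.source) ∩ e'.target with hS
  have himg : e.symm ⁻¹' (A ∩ e'.source) ∩ e.target = (e ∘ e'.symm) '' S := by
    ext u
    constructor
    · rintro ⟨⟨h1, h2⟩, h3⟩
      exact ⟨e' (e.symm u), ⟨by simp [e'.left_inv h2, h1, e.map_target h3], e'.map_source h2⟩,
        by simp [e'.left_inv h2, e.right_inv h3]⟩
    · rintro ⟨w, ⟨⟨h1, h2⟩, h3⟩, rfl⟩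
      exact ⟨by simp [e.left_inv h2, h1, e'.map_target h3], by simp [e.map_source h2]⟩
  have hinj : Set.InjOn (e ∘ e'.symm) S := by
    intro u hu v hv huv
    exact e'.symm.injOn hu.2 hv.2 (e.injOn hu.1.2 hv.1.2 huv)
  have hder : ∀ u ∈ S, HasFDerivWithinAt (e ∘ e'.symm) (fderiv ℝ (e ∘ e'.symm) u) S u := by
    intro u hu
    have := differentiableAt_transition he he' hu.1.2 (e'.map_target hu.2)
    rw [e'.right_inv hu.2] at this
    exact this.hasFDerivAt.hasFDerivWithinAt
  rw [himg, lintegral_image_eq_lintegral_abs_det_fderiv_mul _ (measurableSet_symm_preimage e' hA1)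
    hder hinj]
  refine setLIntegral_congr_fun (measurableSet_symm_preimage e' hA1) fun u hu => ?_
  have hp' := e'.map_target hu.2
  have hJ := det_fderiv_transition e e' (e'.symm u)
  rw [e'.right_inv hu.2] at hJ
  simp only [Function.comp_apply, e.left_inv hu.1.2]
  rw [hJ, secondForm_change hx hr he he' hu.1.2 hp', ← ENNReal.ofReal_mul (abs_nonneg _),
    Matrix.det_mul, Matrix.det_mul, Matrix.det_transpose]
  congr 1
  set J := (jac e e' (e'.symm u)).det
  rw [← Real.sqrt_sq (abs_nonneg J), ← Real.sqrt_mul (sq_nonneg _), abs_mul, abs_mul]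
  ring_nf

/-- On the domain of a chart the area measure is the area measure of the chart. -/
theorem areaII_apply (hx : IsPosCurvedSurface r x ξ) (hr : 2 ≤ r) (q : M)
    {A : Set M} (hA : MeasurableSet A) (hAq : A ⊆ (chartAt E2 q).source) :
    areaII x ξ A = chartAreaII x ξ (chartAt E2 q) A := by
  apply le_antisymm
  · -- Compare with the measure that is infinite outside the domain of the chart.
    set U := (chartAt E2 q).source
    have hU : MeasurableSet U := (chartAt E2 q).open_source.measurableSet
    have hle : areaII x ξ ≤ chartAreaII x ξ (chartAt E2 q) + (⊤ : Measure M).restrict Uᶜ := by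
      refine iSup_le fun p => Measure.le_iff.2 fun B hB => ?_
      rw [Measure.add_apply, Measure.restrict_apply hB]
      by_cases h : (B ∩ Uᶜ).Nonempty
      · obtain ⟨b, hb⟩ := h
        have h1 : ((⊤ : ENNReal) • Measure.dirac b) (B ∩ Uᶜ) ≤ (⊤ : Measure M) (B ∩ Uᶜ) :=
          (le_top : ((⊤ : ENNReal) • Measure.dirac b) ≤ (⊤ : Measure M)) _
        have h2 : (⊤ : Measure M) (B ∩ Uᶜ) = ⊤ := by
          simpa [Measure.dirac_apply' b (hB.inter hU.compl), Set.indicator_of_mem hb] using h1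
        simp [h2]
      · have hBU : B ∩ U = B := Set.inter_eq_left.2 fun b hb => by
          by_contra hbU
          exact h ⟨b, hb, hbU⟩
        calc chartAreaII x ξ (chartAt E2 p) B = chartAreaII x ξ (chartAt E2 p) (B ∩ U) := by
              rw [hBU]
          _ = chartAreaII x ξ (chartAt E2 q) (B ∩ (chartAt E2 p).source) :=
              chartAreaII_inter_eq hx hr (chart_mem_atlas E2 q) (chart_mem_atlas E2 p) hB
          _ ≤ chartAreaII x ξ (chartAt E2 q) B := measure_mono Set.inter_subset_left
          _ ≤ _ := le_self_add
    refine (hle A).trans ?_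
    have : A ∩ Uᶜ = ∅ := by
      rw [← Set.sdiff_eq, Set.sdiff_eq_empty]; exact hAq
    simp [Measure.restrict_apply hA, this]
  · exact le_iSup (fun p : M => chartAreaII x ξ (chartAt E2 p)) q A

theorem areaII_restrict_source (hx : IsPosCurvedSurface r x ξ) (hr : 2 ≤ r) (q : M) :
    (areaII x ξ).restrict (chartAt E2 q).source = chartAreaII x ξ (chartAt E2 q) := by
  ext A hA
  rw [Measure.restrict_apply hA, areaII_apply hx hr q
    (hA.inter (chartAt E2 q).open_source.measurableSet) Set.inter_subset_right,
    chartAreaII_inter_source hA]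

/-- The integral of a function supported in the domain of a chart, in coordinates. -/
theorem integral_areaII_eq (hx : IsPosCurvedSurface r x ξ) (hr : 2 ≤ r) (q : M) {f : M → ℝ}
    (hf : Continuous f) (hf0 : ∀ m ∉ (chartAt E2 q).source, f m = 0) :
    ∫ m, f m ∂(areaII x ξ) = ∫ u in (chartAt E2 q).target,
      √|(secondForm (chartAt E2 q) x ξ ((chartAt E2 q).symm u)).det| *
        f ((chartAt E2 q).symm u) := by
  set e := chartAt E2 q
  have hcont : ContinuousOn (fun u => (secondForm e x ξ (e.symm u)).det) e.target :=
    (chartContDiff_det (chartContDiff_secondForm (k := 0) hx (by simpa using hr)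
      (chart_mem_atlas E2 q))).continuousOn
  rw [← setIntegral_eq_integral_of_forall_compl_eq_zero hf0, areaII_restrict_source hx hr q,
    chartAreaII, integral_map (aemeasurable_symm e _) hf.aestronglyMeasurable,
    integral_withDensity_eq_integral_toReal_smul₀]
  · simp only [ENNReal.toReal_ofReal (Real.sqrt_nonneg _), smul_eq_mul]
    rfl
  · exact (hcont.abs.sqrt.aemeasurable e.open_target.measurableSet).ennreal_ofReal
  · simp

/-- The area of an open set in a chart domain, in coordinates. -/
theorem areaII_image_symm (hx : IsPosCurvedSurface r x ξ) (hr : 2 ≤ r) (q : M) {W : Set E2}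
    (hW : IsOpen W) (hWq : W ⊆ (chartAt E2 q).target) :
    areaII x ξ ((chartAt E2 q).symm '' W) = ∫⁻ u in W,
      ENNReal.ofReal √|(secondForm (chartAt E2 q) x ξ ((chartAt E2 q).symm u)).det| := by
  set e := chartAt E2 q
  have hO : IsOpen (e.symm '' W) := e.symm.isOpen_image_of_subset_source hW hWq
  rw [areaII_apply hx hr q hO.measurableSet ?_, chartAreaII_apply hO.measurableSet]
  · congr 2
    ext u
    constructor
    · rintro ⟨⟨w, hw, hwu⟩, hu⟩
      rwa [← e.symm.injOn (hWq hw) hu hwu]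
    · exact fun hu => ⟨⟨u, hu, rfl⟩, hWq hu⟩
  · rintro _ ⟨w, hw, rfl⟩
    exact e.map_target (hWq hw)

omit [MeasurableSpace M] [BorelSpace M] in
theorem continuousAt_density (hx : IsPosCurvedSurface r x ξ) (hr : 2 ≤ r) (p : M) :
    ContinuousAt (fun u => √|(secondForm (chartAt E2 p) x ξ ((chartAt E2 p).symm u)).det|)
      (chartAt E2 p p) :=
  ((chartContDiff_det (chartContDiff_secondForm (k := 0) hx (by simpa using hr)
    (chart_mem_atlas E2 p))).contDiffAt (mem_chart_source E2 p)).continuousAt.abs.sqrt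

theorem isFiniteMeasure_areaII [CompactSpace M] (hx : IsPosCurvedSurface r x ξ) (hr : 2 ≤ r) :
    IsFiniteMeasure (areaII x ξ) := by
  have : IsLocallyFiniteMeasure (areaII x ξ) := by
    refine ⟨fun p => ?_⟩
    have hd := (continuousAt_density hx hr p).eventually (gt_mem_nhds (lt_add_one _))
    set e := chartAt E2 p
    have hp := mem_chart_source E2 p
    obtain ⟨W, hW, hWo, hpW⟩ := eventually_nhds_iff.1
      ((hd.and (e.open_target.mem_nhds (e.map_source hp))).and (Metric.ball_mem_nhds (e p) one_pos))
    refine ⟨e.symm '' W, (e.symm.isOpen_image_of_subset_source hWo fun w hw =>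
      (hW w hw).1.2).mem_nhds ⟨e p, hpW, e.left_inv hp⟩, ?_⟩
    rw [areaII_image_symm hx hr p hWo fun w hw => (hW w hw).1.2]
    refine (setLIntegral_mono' hWo.measurableSet fun w hw =>
      ENNReal.ofReal_le_ofReal (hW w hw).1.1.le).trans_lt ?_
    rw [setLIntegral_const]
    exact ENNReal.mul_lt_top ENNReal.ofReal_lt_top
      ((measure_mono fun w hw => (hW w hw).2).trans_lt measure_ball_lt_top)
  exact CompactSpace.isFiniteMeasure

theorem isOpenPosMeasure_areaII (hx : IsPosCurvedSurface r x ξ) (hr : 2 ≤ r) :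
    (areaII x ξ).IsOpenPosMeasure := by
  refine ⟨fun O hO ⟨p, hpO⟩ => ?_⟩
  have hp := mem_chart_source E2 p
  have hpos :
      0 < √|(secondForm (chartAt E2 p) x ξ ((chartAt E2 p).symm (chartAt E2 p p))).det| := by
    rw [(chartAt E2 p).left_inv hp]
    exact Real.sqrt_pos.2 (abs_pos.2 (det_secondForm_pos hx hr (chart_mem_atlas E2 p) hp).ne')
  have hd := (continuousAt_density hx hr p).eventually (lt_mem_nhds (half_lt_self hpos))
  set c := √|(secondForm (chartAt E2 p) x ξ ((chartAt E2 p).symm (chartAt E2 p p))).det|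
  set e := chartAt E2 p
  have hOe : ∀ᶠ u in nhds (e p), e.symm u ∈ O := by
    refine (e.symm.continuousAt (e.map_source hp)).eventually (hO.mem_nhds ?_)
    rwa [e.left_inv hp]
  obtain ⟨W, hW, hWo, hpW⟩ := eventually_nhds_iff.1
    ((hd.and (e.open_target.mem_nhds (e.map_source hp))).and hOe)
  have h1 : e.symm '' W ⊆ O := by rintro _ ⟨w, hw, rfl⟩; exact (hW w hw).2
  have h2 : 0 < areaII x ξ (e.symm '' W) := by
    rw [areaII_image_symm hx hr p hWo fun w hw => (hW w hw).1.2]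
    refine lt_of_lt_of_le ?_ (setLIntegral_mono' hWo.measurableSet fun w hw =>
      ENNReal.ofReal_le_ofReal (hW w hw).1.1.le)
    rw [setLIntegral_const]
    exact ENNReal.mul_pos (ENNReal.ofReal_pos.2 (half_pos hpos)).ne'
      (hWo.measure_pos volume ⟨_, hpW⟩).ne'
  exact (h2.trans_le (measure_mono h1)).ne'

end Area

/-! ### The divergence theorem -/

section Divergence

variable {M : Type*} [TopologicalSpace M] {e : OpenPartialHomeomorph M E2}
  {r : WithTop ℕ∞} {p : M} {x ξ : M → E3}

/-- The integral of a partial derivative of a function with compact support in the chart domain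
vanishes. -/
theorem integral_pd_eq_zero {P : M → ℝ} (hP : ChartContDiff e 1 P) {K : Set M} (hK : IsCompact K)
    (hKe : K ⊆ e.source) (hPK : ∀ m ∉ K, P m = 0) (i : Fin 2) :
    IntegrableOn (fun u => pd e P i (e.symm u)) e.target ∧
      ∫ u in e.target, pd e P i (e.symm u) = 0 := by
  classical
  set L := e '' K with hL
  have hLc : IsCompact L := hK.image_of_continuousOn (e.continuousOn.mono hKe)
  have hLt : L ⊆ e.target := by rintro _ ⟨m, hm, rfl⟩; exact e.map_source (hKe hm)
  -- The extension of `P` by zero from the chart to the whole plane.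
  set Q : E2 → ℝ := e.target.indicator (P ∘ e.symm) with hQ
  have hQL : ∀ u ∉ L, Q u = 0 := by
    intro u hu
    by_cases hut : u ∈ e.target
    · rw [hQ, Set.indicator_of_mem hut]
      exact hPK _ fun h => hu ⟨_, h, e.right_inv hut⟩
    · exact Set.indicator_of_notMem hut _
  have hQt : ∀ u ∈ e.target, Q =ᶠ[nhds u] P ∘ e.symm := fun u hu =>
    Filter.eventuallyEq_of_mem (e.open_target.mem_nhds hu) fun w hw => Set.indicator_of_mem hw _
  have hQ0 : ∀ u ∉ e.target, Q =ᶠ[nhds u] fun _ => 0 := fun u hu =>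
    Filter.eventuallyEq_of_mem (hLc.isClosed.isOpen_compl.mem_nhds fun h => hu (hLt h))
      fun w hw => hQL w hw
  have hQc : ContDiff ℝ 1 Q := by
    refine contDiff_iff_contDiffAt.2 fun u => ?_
    by_cases hu : u ∈ e.target
    · exact (ContDiffOn.contDiffAt hP (e.open_target.mem_nhds hu)).congr_of_eventuallyEq (hQt u hu)
    · exact contDiffAt_const.congr_of_eventuallyEq (hQ0 u hu)
  have hQs : HasCompactSupport Q := HasCompactSupport.intro hLc hQL
  have hQd : Continuous fun u => fderiv ℝ Q u (EuclideanSpace.single i 1) :=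
    (hQc.continuous_fderiv one_ne_zero).clm_apply continuous_const
  have hQds : HasCompactSupport fun u => fderiv ℝ Q u (EuclideanSpace.single i 1) :=
    hQs.fderiv_apply ℝ _
  have hint := hQd.integrable_of_hasCompactSupport (μ := volume) hQds
  have heq : Set.EqOn (fun u => fderiv ℝ Q u (EuclideanSpace.single i 1))
      (fun u => pd e P i (e.symm u)) e.target := fun u hu => by
    simp only [pd, e.right_inv hu, (hQt u hu).fderiv_eq]
  refine ⟨hint.integrableOn.congr_fun heq e.open_target.measurableSet, ?_⟩
  rw [← setIntegral_congr_fun e.open_target.measurableSet heq,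
    setIntegral_eq_integral_of_forall_compl_eq_zero fun u hu => by simp [(hQ0 u hu).fderiv_eq]]
  have := integral_smul_fderiv_eq_neg_fderiv_smul_of_integrable (μ := (volume : Measure E2))
    (f := fun _ => (1 : ℝ)) (g := Q) (v := EuclideanSpace.single i 1) (by simp)
    (by simpa using hint)
    (by simpa using hQc.continuous.integrable_of_hasCompactSupport hQs)
    (fun _ _ => differentiableAt_const _)
    (fun _ _ => (hQc.differentiable one_ne_zero).differentiableAt)
  simpa using this

variable [ChartedSpace E2 M]

theorem relMeanCurv_eq_zero_of_eventuallyEq {Z : M → E3} (hZ : ∀ᶠ m in nhds p, Z m = 0) :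
    relMeanCurv x Z p = 0 := by
  have h1 : ∀ i, pd (chartAt E2 p) Z i p = 0 := by
    intro i
    set e := chartAt E2 p
    have hp := mem_chart_source E2 p
    have h2 : Z ∘ e.symm =ᶠ[nhds (e p)] fun _ => 0 := by
      have := e.symm.continuousAt (e.map_source hp)
      rw [ContinuousAt, e.left_inv hp] at this
      exact this.eventually hZ
    simp [pd, h2.fderiv_eq]
  simp [relMeanCurv, trace_shapeCoeff, h1]

variable [IsManifold (𝓡 2) 1 M]

theorem relMeanCurv_sum {ι : Type*} (s : Finset ι) {Z : ι → M → E3}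
    (hZ : ∀ a ∈ s, ContMDiff (𝓡 2) 𝓘(ℝ, E3) 1 (Z a)) (p : M) :
    relMeanCurv x (fun m => ∑ a ∈ s, Z a m) p = ∑ a ∈ s, relMeanCurv x (Z a) p := by
  have h1 : ∀ i, pd (chartAt E2 p) (fun m => ∑ a ∈ s, Z a m) i p =
      ∑ a ∈ s, pd (chartAt E2 p) (Z a) i p := pd_sum s fun a ha =>
    (chartContDiff_of_contMDiff (hZ a ha) (chart_mem_atlas E2 p)).differentiableAt le_rfl
      (mem_chart_source E2 p)
  simp only [relMeanCurv, trace_shapeCoeff, h1, sum_inner, Finset.sum_mul, ← Finset.sum_sub_distrib,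
    ← Finset.sum_add_distrib, ← Finset.sum_neg_distrib, Finset.sum_div, Finset.mul_sum]

/-- A nonnegative `C^1` function, positive at `p`, with support in the chart domain at `p`. -/
theorem exists_bump [T2Space M] (p : M) : ∃ ψ : M → ℝ, ContMDiff (𝓡 2) 𝓘(ℝ, ℝ) 1 ψ ∧
    (∀ m, 0 ≤ ψ m) ∧ 0 < ψ p ∧ tsupport ψ ⊆ (chartAt E2 p).source := by
  classical
  set e := chartAt E2 p
  have hp := mem_chart_source E2 p
  obtain ⟨ε, hε, hball⟩ := Metric.nhds_basis_closedBall.mem_iff.1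
    (e.open_target.mem_nhds (e.map_source hp))
  let b : ContDiffBump (e p) := ⟨ε / 2, ε, half_pos hε, half_lt_self hε⟩
  set K := e.symm '' Metric.closedBall (e p) ε with hK
  have hKc : IsCompact K :=
    (isCompact_closedBall _ _).image_of_continuousOn (e.symm.continuousOn.mono hball)
  have hKe : K ⊆ e.source := by rintro _ ⟨u, hu, rfl⟩; exact e.map_target (hball hu)
  let ψ : M → ℝ := e.source.indicator (fun m => b (e m))
  have hψK : ∀ m ∉ K, ψ m = 0 := by
    intro m hm
    by_cases hme : m ∈ e.source
    · rw [show ψ m = b (e m) from Set.indicator_of_mem hme _]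
      refine b.zero_of_le_dist (le_of_not_ge fun h => hm ⟨e m, h, e.left_inv hme⟩)
    · exact Set.indicator_of_notMem hme _
  refine ⟨ψ, fun m => ?_, fun m => Set.indicator_nonneg (fun _ _ => b.nonneg) m, ?_, ?_⟩
  · by_cases hm : m ∈ e.source
    · refine contMDiffAt_of_chartContDiff (chart_mem_atlas E2 p) (?_ : ChartContDiff e 1 ψ) hm
      refine b.contDiff.contDiffOn.congr fun u hu => ?_
      simp [ψ, Set.indicator_of_mem (e.map_target hu), e.right_inv hu]
    · refine contMDiffAt_const (c := (0 : ℝ)) |>.congr_of_eventuallyEq ?_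
      exact Filter.eventuallyEq_of_mem (hKc.isClosed.isOpen_compl.mem_nhds fun h => hm (hKe h))
        fun w hw => hψK w hw
  · rw [show ψ p = b (e p) from Set.indicator_of_mem hp _]
    exact b.pos_of_mem_ball (Metric.mem_ball_self b.rOut_pos)
  · exact (closure_minimal (fun m hm => by_contra fun h =>
      Function.mem_support.1 hm (hψK m h)) hKc.isClosed).trans hKe

variable [IsManifold (𝓡 2) r M]

/-- The divergence of a tangent vector field `Z` in coordinates. If `Z = a ∂₁x + b ∂₂x`, then
`√g div Z = ∂₁(√g a) + ∂₂(√g b)`, and `div Z` is the negative of the trace of the shape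
coefficients of `Z`. -/
theorem pd_add_pd_eq_neg_trace (hx : IsPosCurvedSurface r x ξ) (hr : 2 ≤ r)
    (he : e ∈ atlas E2 M) {Z : M → E3}
    {a b : M → ℝ} (ha : ChartContDiff e 1 a) (hb : ChartContDiff e 1 b)
    (hab : ∀ m ∈ e.source, Z m = a m • pd e x 0 m + b m • pd e x 1 m) (hp : p ∈ e.source) :
    pd e (fun m => √(firstForm e x m).det * a m) 0 p +
      pd e (fun m => √(firstForm e x m).det * b m) 1 p =
      -(√(firstForm e x p).det * (shapeCoeff e x Z p).trace) := by
  have hr1 : (1 : WithTop ℕ∞) + 1 ≤ r := by rwa [one_add_one_eq_two]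
  have hD := det_firstForm_pos hx (le_trans (by norm_num) hr) he hp
  have hXc := fun i => (hx.chartContDiff he).pd hr1 i
  have hX := fun i => (hXc i).differentiableAt le_rfl hp
  have hGc := chartContDiff_firstForm hx hr1 he
  have hG := fun i j => (hGc i j).differentiableAt le_rfl hp
  have hDd := (chartContDiff_det (chartContDiff_firstForm hx hr1 he)).differentiableAt le_rfl hp
  have ha' := ha.differentiableAt le_rfl hp
  have hb' := hb.differentiableAt le_rfl hp
  have hs : DifferentiableAt ℝ ((fun m => √(firstForm e x m).det) ∘ e.symm) (e p) :=
    DifferentiableAt.sqrt hDd (by simpa [e.left_inv hp] using hD.ne')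
  have hpdG : ∀ i j k, pd e (fun m => firstForm e x m i j) k p =
      inner ℝ (pd e (pd e x i) k p) (pd e x j p) + inner ℝ (pd e x i p) (pd e (pd e x j) k p) :=
    fun i j k => pd_inner (hX i) (hX j) hp k
  have hpdD : ∀ k, pd e (fun m => (firstForm e x m).det) k p =
      pd e (fun m => firstForm e x m 0 0) k p * firstForm e x p 1 1 +
      firstForm e x p 0 0 * pd e (fun m => firstForm e x m 1 1) k p -
      (pd e (fun m => firstForm e x m 0 1) k p * firstForm e x p 1 0 +
      firstForm e x p 0 1 * pd e (fun m => firstForm e x m 1 0) k p) := by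
    intro k
    simp only [Matrix.det_fin_two]
    rw [pd_sub (((hGc 0 0).mul (hGc 1 1)).differentiableAt le_rfl hp)
      (((hGc 0 1).mul (hGc 1 0)).differentiableAt le_rfl hp), pd_mul (hG 0 0) (hG 1 1) hp,
      pd_mul (hG 0 1) (hG 1 0) hp]
  have hpds : ∀ k, pd e (fun m => √(firstForm e x m).det) k p =
      1 / (2 * √(firstForm e x p).det) * pd e (fun m => (firstForm e x m).det) k p :=
    pd_comp (Real.hasDerivAt_sqrt hD.ne') hDd hp
  have hpdZ : ∀ i, pd e Z i p = pd e a i p • pd e x 0 p + a p • pd e (pd e x 0) i p +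
      (pd e b i p • pd e x 1 p + b p • pd e (pd e x 1) i p) := by
    intro i
    rw [pd_congr hab hp, pd_add ((ha.smul (hXc 0)).differentiableAt le_rfl hp)
      ((hb.smul (hXc 1)).differentiableAt le_rfl hp), pd_smul ha' (hX 0) hp,
      pd_smul hb' (hX 1) hp]
  have hcomm := pd_pd_comm ((hx.chartContDiff he).of_le hr) hp 1 0
  rw [pd_mul hs ha' hp, pd_mul hs hb' hp, hpds, hpds, hpdD, hpdD, trace_shapeCoeff]
  have hsq : √(firstForm e x p).det * √(firstForm e x p).det = (firstForm e x p).det :=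
    Real.mul_self_sqrt hD.le
  have hs0 : √(firstForm e x p).det ≠ 0 := (Real.sqrt_pos.2 hD).ne'
  have hdet := Matrix.det_fin_two (firstForm e x p)
  simp only [hpdG, hpdZ, hcomm, inner_add_left, inner_smul_left, conj_trivial]
  set s := √(firstForm e x p).det
  rw [← hsq] at hdet ⊢
  have h01 : firstForm e x p 1 0 = firstForm e x p 0 1 :=
    real_inner_comm (pd e x 0 p) (pd e x 1 p)
  have e00 : inner ℝ (pd e x 0 p) (pd e x 0 p) = firstForm e x p 0 0 := rfl
  have e01 : inner ℝ (pd e x 0 p) (pd e x 1 p) = firstForm e x p 0 1 := rfl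
  have e10 : inner ℝ (pd e x 1 p) (pd e x 0 p) = firstForm e x p 0 1 := h01
  have e11 : inner ℝ (pd e x 1 p) (pd e x 1 p) = firstForm e x p 1 1 := rfl
  have c : ∀ i (v : E3), inner ℝ (pd e x i p) v = inner ℝ v (pd e x i p) := fun i v =>
    real_inner_comm _ _
  rw [h01] at hdet
  simp only [e00, e01, e10, e11, h01, c 0 (pd e (pd e x _) _ p), c 1 (pd e (pd e x _) _ p)]
  field_simp
  linear_combination (2 * pd e a 0 p + 2 * pd e b 1 p) * hdet

/-- The relation `dO_II = q_aff² dO_I` between the area densities, a form of `K = det h / det g`. -/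
theorem sqrt_det_secondForm (hx : IsPosCurvedSurface r x ξ) (hr : 2 ≤ r)
    (he : e ∈ atlas E2 M) (hp : p ∈ e.source) :
    √|(secondForm e x ξ p).det| = √(firstForm e x p).det * qAff x ξ p ^ 2 := by
  have hD := det_firstForm_pos hx (le_trans (by norm_num) hr) he hp
  have hK := hx.curv_pos p
  have hq : qAff x ξ p ^ 2 = √(gaussCurv x ξ p) := by
    rw [qAff, abs_of_pos hK, ← Real.rpow_natCast, ← Real.rpow_mul hK.le, Real.sqrt_eq_rpow]
    norm_num
  have h1 : (secondForm e x ξ p).det = (firstForm e x p).det * gaussCurv x ξ p := by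
    rw [gaussCurv_eq hx hr he hp]
    field_simp
  rw [hq, abs_of_pos (det_secondForm_pos hx hr he hp), h1, Real.sqrt_mul hD.le]

theorem continuous_relMeanCurv_div (hx : IsPosCurvedSurface r x ξ) (hr : 2 ≤ r) {Z : M → E3}
    (hZ : ContMDiff (𝓡 2) 𝓘(ℝ, E3) 1 Z) {f : M → ℝ} (hf : Continuous f) (hf0 : ∀ m, f m ≠ 0) :
    Continuous fun m => relMeanCurv x Z m / f m := by
  have h1 : ContMDiff (𝓡 2) 𝓘(ℝ, ℝ) 0 (relMeanCurv x Z) :=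
    contMDiff_of_chartContDiff fun q => chartContDiff_relMeanCurv hx (le_trans (by norm_num) hr)
      (chart_mem_atlas E2 q) (chartContDiff_of_contMDiff hZ (chart_mem_atlas E2 q))
  exact h1.continuous.div hf hf0

theorem contMDiff_qAff (hx : IsPosCurvedSurface r x ξ) (hr : 3 ≤ r) :
    ContMDiff (𝓡 2) 𝓘(ℝ, ℝ) 1 (qAff x ξ) :=
  contMDiff_of_chartContDiff fun q => chartContDiff_qAff hx (by rwa [one_add_two])
    (chart_mem_atlas E2 q)

variable [MeasurableSpace M] [BorelSpace M]

/-- The divergence theorem for a tangent vector field supported in a chart domain. -/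
theorem integral_relMeanCurv_eq_zero_of_tsupport [CompactSpace M]
    (hx : IsPosCurvedSurface r x ξ) (hr : 3 ≤ r) {Z : M → E3}
    (hZ : ContMDiff (𝓡 2) 𝓘(ℝ, E3) 1 Z) (hZξ : ∀ m, inner ℝ (ξ m) (Z m) = 0) (q : M)
    (hsupp : tsupport Z ⊆ (chartAt E2 q).source) :
    ∫ m, relMeanCurv x Z m / qAff x ξ m ^ 2 ∂(areaII x ξ) = 0 := by
  have hr2 : (2 : WithTop ℕ∞) ≤ r := le_trans (by norm_num) hr
  have hr1 : (1 : WithTop ℕ∞) ≤ r := le_trans (by norm_num) hr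
  have hr1' : (1 : WithTop ℕ∞) + 1 ≤ r := by rwa [one_add_one_eq_two]
  have hq0 : ∀ m, qAff x ξ m ^ 2 ≠ 0 := fun m => pow_ne_zero 2 (qAff_pos hx m).ne'
  have hcont : Continuous fun m => relMeanCurv x Z m / qAff x ξ m ^ 2 :=
    continuous_relMeanCurv_div hx hr2 hZ ((contMDiff_qAff hx hr).continuous.pow 2) hq0
  rw [integral_areaII_eq hx hr2 q hcont fun m hm => ?_]
  swap
  · rw [relMeanCurv_eq_zero_of_eventuallyEq, zero_div]
    exact notMem_tsupport_iff_eventuallyEq.1 fun h => hm (hsupp h)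
  have he := chart_mem_atlas E2 q
  set e := chartAt E2 q
  have hZe := chartContDiff_of_contMDiff hZ he
  have hX := fun i => (hx.chartContDiff he).pd hr1' i
  have hD := fun m (hm : m ∈ e.source) => det_gram_pos (linearIndependent_pd hx hr1 he hm)
  -- The components of `Z` in the chart, by Cramer's rule.
  let D : M → ℝ := fun m => inner ℝ (pd e x 0 m) (pd e x 0 m) * inner ℝ (pd e x 1 m) (pd e x 1 m) -
    inner ℝ (pd e x 0 m) (pd e x 1 m) * inner ℝ (pd e x 1 m) (pd e x 0 m)
  let a : M → ℝ := fun m => (inner ℝ (Z m) (pd e x 0 m) * inner ℝ (pd e x 1 m) (pd e x 1 m) -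
    inner ℝ (Z m) (pd e x 1 m) * inner ℝ (pd e x 0 m) (pd e x 1 m)) / D m
  let b : M → ℝ := fun m => (inner ℝ (Z m) (pd e x 1 m) * inner ℝ (pd e x 0 m) (pd e x 0 m) -
    inner ℝ (Z m) (pd e x 0 m) * inner ℝ (pd e x 0 m) (pd e x 1 m)) / D m
  have hDc : ChartContDiff e 1 D := .sub (.mul (.inner (hX 0) (hX 0)) (.inner (hX 1) (hX 1)))
    (.mul (.inner (hX 0) (hX 1)) (.inner (hX 1) (hX 0)))
  have ha : ChartContDiff e 1 a := .div (.sub (.mul (.inner hZe (hX 0)) (.inner (hX 1) (hX 1)))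
    (.mul (.inner hZe (hX 1)) (.inner (hX 0) (hX 1)))) hDc fun m hm => (hD m hm).ne'
  have hb : ChartContDiff e 1 b := .div (.sub (.mul (.inner hZe (hX 1)) (.inner (hX 0) (hX 0)))
    (.mul (.inner hZe (hX 0)) (.inner (hX 0) (hX 1)))) hDc fun m hm => (hD m hm).ne'
  have hab : ∀ m ∈ e.source, Z m = a m • pd e x 0 m + b m • pd e x 1 m := fun m hm =>
    eq_combination_of_inner_normal_eq_zero (linearIndependent_pd hx hr1 he hm) (hx.norm_normal m)
      (inner_normal_pd hx hr1 he hm) (hZξ m)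
  have hs : ChartContDiff e 1 fun m => √(firstForm e x m).det :=
    ContDiffOn.sqrt (chartContDiff_det (chartContDiff_firstForm hx hr1' he))
      fun u hu => (det_firstForm_pos hx hr1 he (e.map_target hu)).ne'
  have hKc : IsCompact (tsupport Z) := (isClosed_tsupport Z).isCompact
  have hZ0 : ∀ m ∉ tsupport Z, Z m = 0 := fun m hm => image_eq_zero_of_notMem_tsupport hm
  obtain ⟨hi0, h0⟩ := integral_pd_eq_zero (hs.mul ha) hKc hsupp
    (fun m hm => by simp [a, hZ0 m hm]) 0
  obtain ⟨hi1, h1⟩ := integral_pd_eq_zero (hs.mul hb) hKc hsupp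
    (fun m hm => by simp [b, hZ0 m hm]) 1
  have key : ∀ u ∈ e.target, √|(secondForm e x ξ (e.symm u)).det| *
      (relMeanCurv x Z (e.symm u) / qAff x ξ (e.symm u) ^ 2) = -(1 / 2) *
        (pd e (fun m => √(firstForm e x m).det * a m) 0 (e.symm u) +
          pd e (fun m => √(firstForm e x m).det * b m) 1 (e.symm u)) := by
    intro u hu
    have hm := e.map_target hu
    rw [pd_add_pd_eq_neg_trace hx hr2 he ha hb hab hm, sqrt_det_secondForm hx hr2 he hm,
      relMeanCurv_eq hx hr1 he hm hZe]
    have := (qAff_pos hx (e.symm u)).ne'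
    field_simp
  rw [setIntegral_congr_fun e.open_target.measurableSet key, integral_const_mul,
    integral_add hi0 hi1, h0, h1]
  simp

/-- The divergence theorem on the compact surface: as `dO_II = q_aff² dO_I`, the function
`relMeanCurv x Z / q_aff²` is, up to the factor `-1/2`, the divergence of `Z`. -/
theorem integral_relMeanCurv_eq_zero [CompactSpace M] [T2Space M]
    (hx : IsPosCurvedSurface r x ξ) (hr : 3 ≤ r) {Z : M → E3}
    (hZ : ContMDiff (𝓡 2) 𝓘(ℝ, E3) 1 Z) (hZξ : ∀ m, inner ℝ (ξ m) (Z m) = 0) :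
    ∫ m, relMeanCurv x Z m / qAff x ξ m ^ 2 ∂(areaII x ξ) = 0 := by
  have hr2 : (2 : WithTop ℕ∞) ≤ r := le_trans (by norm_num) hr
  -- Decompose `Z` into fields supported in chart domains, by normalized bump functions.
  choose ψ hψ hψ0 hψp hψs using fun p : M => exists_bump p
  obtain ⟨t, ht⟩ := isCompact_univ.elim_finite_subcover (fun p : M => {m | 0 < ψ p m})
    (fun p => isOpen_lt continuous_const (hψ p).continuous)
    fun p _ => Set.mem_iUnion.2 ⟨p, hψp p⟩
  set S : M → ℝ := fun m => ∑ p ∈ t, ψ p m with hS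
  have hS0 : ∀ m, 0 < S m := by
    intro m
    obtain ⟨p, hp, hpm⟩ : ∃ p ∈ t, 0 < ψ p m := by simpa using ht (Set.mem_univ m)
    exact Finset.sum_pos' (fun q _ => hψ0 q m) ⟨p, hp, hpm⟩
  have hSc : ContMDiff (𝓡 2) 𝓘(ℝ, ℝ) 1 S := contMDiff_finsetSum fun p _ => hψ p
  let Y : M → M → E3 := fun p m => (ψ p m / S m) • Z m
  have hY : ∀ p, ContMDiff (𝓡 2) 𝓘(ℝ, E3) 1 (Y p) := fun p =>
    ((hψ p).div₀ hSc fun m => (hS0 m).ne').smul hZ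
  have hZY : Z = fun m => ∑ p ∈ t, Y p m := by
    funext m
    simp only [Y, ← Finset.sum_smul, ← Finset.sum_div]
    rw [div_self (hS0 m).ne', one_smul]
  have := isFiniteMeasure_areaII hx hr2
  calc ∫ m, relMeanCurv x Z m / qAff x ξ m ^ 2 ∂(areaII x ξ)
      = ∫ m, ∑ p ∈ t, relMeanCurv x (Y p) m / qAff x ξ m ^ 2 ∂(areaII x ξ) := by
        refine integral_congr_ae (Filter.Eventually.of_forall fun m => ?_)
        simp only
        rw [hZY, relMeanCurv_sum t (fun p _ => hY p), Finset.sum_div]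
    _ = ∑ p ∈ t, ∫ m, relMeanCurv x (Y p) m / qAff x ξ m ^ 2 ∂(areaII x ξ) :=
        integral_finsetSum _ fun p _ => (continuous_relMeanCurv_div hx hr2 (hY p)
          ((contMDiff_qAff hx hr).continuous.pow 2) fun m => pow_ne_zero 2
            (qAff_pos hx m).ne').integrable_of_hasCompactSupport
              (HasCompactSupport.of_compactSpace _)
    _ = 0 := Finset.sum_eq_zero fun p _ =>
        integral_relMeanCurv_eq_zero_of_tsupport hx hr (hY p)
          (fun m => by simp [Y, inner_smul_right, hZξ]) p
          ((closure_mono fun m hm => Function.mem_support.2 fun h =>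
            Function.mem_support.1 hm (by simp [Y, h])).trans (hψs p))

end Divergence

/-! ### The rank conditions -/

section Rank

variable {a : Fin 2 → E3} {ν v : E3}

/-- If adding `v` to a basis of a plane does not increase the rank, then `v` lies in the plane. -/
theorem inner_eq_zero_of_finrank_eq_two (ha : LinearIndependent ℝ a)
    (hνa : ∀ i, inner ℝ ν (a i) = 0) (hv : Set.finrank ℝ {a 0, a 1, v} = 2) :
    inner ℝ ν v = 0 := by
  have hle : Submodule.span ℝ (Set.range a) ≤ Submodule.span ℝ {a 0, a 1, v} := by
    refine Submodule.span_mono ?_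
    rintro _ ⟨i, rfl⟩
    fin_cases i <;> simp
  have heq := Submodule.eq_of_le_of_finrank_eq hle
    ((by simpa using finrank_span_eq_card ha : Module.finrank ℝ _ = 2).trans hv.symm)
  refine inner_eq_zero_of_mem_span hνa ?_
  rw [heq]
  exact Submodule.subset_span (by simp)

theorem inner_ne_zero_of_finrank_eq_three (ha : LinearIndependent ℝ a) (hν : ‖ν‖ = 1)
    (hνa : ∀ i, inner ℝ ν (a i) = 0) (hv : Set.finrank ℝ {a 0, a 1, v} = 3) :
    inner ℝ ν v ≠ 0 := by
  intro h
  have hmem : ∀ i, a i ∈ Submodule.span ℝ (Set.range a) := fun i =>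
    Submodule.subset_span (Set.mem_range_self i)
  have hvm : v ∈ Submodule.span ℝ (Set.range a) := by
    rw [eq_combination_of_inner_normal_eq_zero ha hν hνa h]
    exact add_mem (Submodule.smul_mem _ _ (hmem 0)) (Submodule.smul_mem _ _ (hmem 1))
  have hle : Submodule.span ℝ {a 0, a 1, v} ≤ Submodule.span ℝ (Set.range a) := by
    refine Submodule.span_le.2 ?_
    rintro w (rfl | rfl | rfl)
    exacts [hmem 0, hmem 1, hvm]
  have h2 : Module.finrank ℝ (Submodule.span ℝ (Set.range a)) = 2 := by
    simpa using finrank_span_eq_card ha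
  have h3 := Submodule.finrank_mono hle
  rw [h2] at h3
  change Module.finrank ℝ (Submodule.span ℝ {a 0, a 1, v}) = 3 at hv
  omega

end Rank

/-! ### Comparison with the equiaffine normalization -/

section Comparison

variable {M : Type*} [TopologicalSpace M] [ChartedSpace E2 M]
  [IsManifold (𝓡 2) 1 M] {r : WithTop ℕ∞} [IsManifold (𝓡 2) r M] {p : M} {x ξ y : M → E3}

omit [IsManifold (𝓡 2) r M] in
theorem support_ne_zero (hx : IsPosCurvedSurface r x ξ) (hr : 1 ≤ r) {s : WithTop ℕ∞}
    (hy : IsRelativeNormalization s x y) (p : M) : support ξ y p ≠ 0 :=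
  inner_ne_zero_of_finrank_eq_three (linearIndependent_pd hx hr (chart_mem_atlas E2 p)
    (mem_chart_source E2 p)) (hx.norm_normal p) (hx.normal_orthogonal p) (hy.rank_three p)

theorem contMDiff_support (hx : IsPosCurvedSurface r x ξ) (hr : 2 ≤ r)
    (hy : ContMDiff (𝓡 2) 𝓘(ℝ, E3) 1 y) : ContMDiff (𝓡 2) 𝓘(ℝ, ℝ) 1 (support ξ y) :=
  contMDiff_of_chartContDiff fun q => .inner
    (hx.chartContDiff_normal (by rwa [one_add_one_eq_two]) (chart_mem_atlas E2 q))
    (chartContDiff_of_contMDiff hy (chart_mem_atlas E2 q))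

/-- The support function of a relative normalization satisfies `∂ᵢ q = ⟨∂ᵢ ξ, y⟩`, because `∂ᵢ y` is
tangent. -/
theorem pd_support (hx : IsPosCurvedSurface r x ξ) (hr : 2 ≤ r) {s : WithTop ℕ∞} (hs : 1 ≤ s)
    (hy : IsRelativeNormalization s x y) (p : M) (i : Fin 2) :
    pd (chartAt E2 p) (support ξ y) i p = inner ℝ (pd (chartAt E2 p) ξ i p) (y p) := by
  have he := chart_mem_atlas E2 p
  have hp := mem_chart_source E2 p
  have h1 : inner ℝ (ξ p) (pd (chartAt E2 p) y i p) = 0 :=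
    inner_eq_zero_of_finrank_eq_two (linearIndependent_pd hx (le_trans (by norm_num) hr) he hp)
      (hx.normal_orthogonal p) (hy.rank_two p i)
  have h2 := pd_inner ((hx.chartContDiff_normal (by rwa [one_add_one_eq_two]) he).differentiableAt
    le_rfl hp) ((chartContDiff_of_contMDiff (hy.contMDiff.of_le hs) he).differentiableAt le_rfl hp)
    hp i
  rw [h1, add_zero] at h2
  exact h2

/-- The tangent vector field `q_aff² (y / q - y_aff / q_aff)`. -/
noncomputable def diffField (x ξ y : M → E3) (m : M) : E3 :=
  (qAff x ξ m ^ 2 / support ξ y m) • y m - qAff x ξ m • yAff x ξ m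

omit [IsManifold (𝓡 2) 1 M] [IsManifold (𝓡 2) r M] in
theorem inner_normal_diffField (hx : IsPosCurvedSurface r x ξ) (h0 : support ξ y p ≠ 0) :
    inner ℝ (ξ p) (diffField x ξ y p) = 0 := by
  have h1 : inner ℝ (ξ p) (yAff x ξ p) = qAff x ξ p := support_yAff hx p
  have h2 : inner ℝ (ξ p) (y p) = support ξ y p := rfl
  rw [diffField, inner_sub_right, inner_smul_right, inner_smul_right, h1, h2]
  field_simp
  ring

theorem contMDiff_diffField (hx : IsPosCurvedSurface r x ξ) (hr : 3 ≤ r)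
    (ha : ContMDiff (𝓡 2) 𝓘(ℝ, E3) 1 (yAff x ξ)) (hy : ContMDiff (𝓡 2) 𝓘(ℝ, E3) 1 y)
    (h0 : ∀ m, support ξ y m ≠ 0) : ContMDiff (𝓡 2) 𝓘(ℝ, E3) 1 (diffField x ξ y) :=
  have hq := contMDiff_qAff hx hr
  (((hq.pow 2).div₀ (contMDiff_support hx (le_trans (by norm_num) hr) hy) h0).smul hy).sub
    (hq.smul ha)

/-- The function `H / q - H_aff / q_aff` with the divergence of `diffField` removed; this does not
change the integral over a compact surface. -/
noncomputable def curvDefect (x ξ y : M → E3) (m : M) : ℝ :=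
  relMeanCurv x y m / support ξ y m - relMeanCurv x (yAff x ξ) m / qAff x ξ m -
    relMeanCurv x (diffField x ξ y) m / qAff x ξ m ^ 2

/-- With `y = q (ξ + T)`, `y_aff = q_aff (ξ + T_aff)` and `T`, `T_aff` tangent, the defect is
`II (T - T_aff, T - T_aff) / 2`; so it is nonnegative, and zero only where `y` and `y_aff` are
proportional. -/
theorem curvDefect_nonneg_and_eq (hx : IsPosCurvedSurface r x ξ) (hr : 3 ≤ r)
    (hII : ∀ p, (secondForm (chartAt E2 p) x ξ p).PosDef)
    (ha : ContMDiff (𝓡 2) 𝓘(ℝ, E3) 1 (yAff x ξ)) {s : WithTop ℕ∞} (hs : 1 ≤ s)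
    (hy : IsRelativeNormalization s x y) (p : M) :
    0 ≤ curvDefect x ξ y p ∧
      (curvDefect x ξ y p = 0 → y p = (support ξ y p / qAff x ξ p) • yAff x ξ p) := by
  have hr2 : (2 : WithTop ℕ∞) ≤ r := le_trans (by norm_num) hr
  have hr1 : (1 : WithTop ℕ∞) ≤ r := le_trans (by norm_num) hr
  have h0 := support_ne_zero hx hr1 hy
  have hqa0 := (qAff_pos hx p).ne'
  have hy1 := hy.contMDiff.of_le hs
  have hpd_q := pd_support hx hr2 hs hy p
  have hpd_qa := inner_pd_normal_yAff hx hr (chart_mem_atlas E2 p) (mem_chart_source E2 p)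
  have hPD := hII p
  have he := chart_mem_atlas E2 p
  have hp := mem_chart_source E2 p
  have horth := hx.normal_orthogonal p
  have hHdef : ∀ Z : M → E3, relMeanCurv x Z p =
    (1 / 2) * (shapeCoeff (chartAt E2 p) x Z p).trace := fun _ => rfl
  set e := chartAt E2 p
  have hli := linearIndependent_pd hx hr1 he hp
  -- The tangential components of the two normalizations.
  have hdec : ∀ v : E3, ∃ t₀ t₁ : ℝ,
      v = inner ℝ (ξ p) v • ξ p + (t₀ • pd e x 0 p + t₁ • pd e x 1 p) := by
    intro v
    refine ⟨_, _, eq_add_of_sub_eq' (eq_combination_of_inner_normal_eq_zero hli (hx.norm_normal p)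
      horth ?_)⟩
    simp [inner_sub_right, inner_smul_right, hx.norm_normal]
  obtain ⟨t₀, t₁, ht⟩ := hdec (y p)
  obtain ⟨τ₀, τ₁, hτ⟩ := hdec (yAff x ξ p)
  have hqy : inner ℝ (ξ p) (y p) = support ξ y p := rfl
  have hqa : inner ℝ (ξ p) (yAff x ξ p) = qAff x ξ p := support_yAff hx p
  rw [hqy] at ht
  rw [hqa] at hτ
  set q := support ξ y p with hq
  set qa := qAff x ξ p
  set h := secondForm e x ξ p with hh
  have hνX : ∀ i j, inner ℝ (pd e ξ i p) (pd e x j p) = -h j i := fun i j => by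
    rw [hh, secondForm_eq_neg hx hr2 he hp, neg_neg]
  have hνν := inner_pd_normal_normal hx hr2 he hp
  have hsymm : h 1 0 = h 0 1 := secondForm_symm hx hr2 he hp 1 0
  have hqi : ∀ i, pd e (support ξ y) i p = -(h 0 i * t₀ + h 1 i * t₁) := by
    intro i
    rw [hpd_q, ht]
    simp only [inner_add_right, inner_smul_right, hνν, hνX]
    ring
  have hqai : ∀ i, pd e (qAff x ξ) i p = -(h 0 i * τ₀ + h 1 i * τ₁) := by
    intro i
    rw [← hpd_qa, hτ]
    simp only [inner_add_right, inner_smul_right, hνν, hνX]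
    ring
  -- The derivatives of the tangent field.
  have hqd := (chartContDiff_of_contMDiff (contMDiff_support hx hr2 hy1) he)
  have hqad := (chartContDiff_of_contMDiff (contMDiff_qAff hx hr) he)
  have hyd := (chartContDiff_of_contMDiff hy1 he)
  have had := (chartContDiff_of_contMDiff ha he)
  let c : M → ℝ := fun m => qAff x ξ m ^ 2 / support ξ y m
  have hcd : ChartContDiff e 1 c := .div (ContDiffOn.pow hqad 2) hqd fun m _ => h0 m
  have hci : ∀ i, pd e c i p * q = 2 * qa * pd e (qAff x ξ) i p -
      c p * pd e (support ξ y) i p := by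
    intro i
    have h1 := pd_mul (hcd.differentiableAt le_rfl hp) (hqd.differentiableAt le_rfl hp) hp i
    have h2 := pd_mul (hqad.differentiableAt le_rfl hp) (hqad.differentiableAt le_rfl hp) hp i
    rw [pd_congr (g := fun m => qAff x ξ m * qAff x ξ m) (fun m _ => by
      have := h0 m
      simp only [c]
      field_simp) hp, h2] at h1
    linarith
  have hZi : ∀ i, pd e (diffField x ξ y) i p = (pd e c i p • y p + c p • pd e y i p) -
      (pd e (qAff x ξ) i p • yAff x ξ p + qa • pd e (yAff x ξ) i p) := by
    intro i
    rw [← pd_smul (hcd.differentiableAt le_rfl hp) (hyd.differentiableAt le_rfl hp) hp,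
      ← pd_smul (hqad.differentiableAt le_rfl hp) (had.differentiableAt le_rfl hp) hp,
      ← pd_sub ((hcd.smul hyd).differentiableAt le_rfl hp)
        ((hqad.smul had).differentiableAt le_rfl hp)]
    rfl
  have hR : relMeanCurv x (diffField x ξ y) p = c p * relMeanCurv x y p -
      qa * relMeanCurv x (yAff x ξ) p - 1 / 2 * ((pd e c 0 p * t₀ + pd e c 1 p * t₁) -
        (pd e (qAff x ξ) 0 p * τ₀ + pd e (qAff x ξ) 1 p * τ₁)) := by
    have hD' : (firstForm e x p).det ≠ 0 := (det_firstForm_pos hx hr1 he hp).ne'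
    have hdet := Matrix.det_fin_two (firstForm e x p)
    have h01 : firstForm e x p 1 0 = firstForm e x p 0 1 :=
      real_inner_comm (pd e x 0 p) (pd e x 1 p)
    have e00 : inner ℝ (pd e x 0 p) (pd e x 0 p) = firstForm e x p 0 0 := rfl
    have e01 : inner ℝ (pd e x 0 p) (pd e x 1 p) = firstForm e x p 0 1 := rfl
    have e10 : inner ℝ (pd e x 1 p) (pd e x 0 p) = firstForm e x p 0 1 := h01
    have e11 : inner ℝ (pd e x 1 p) (pd e x 1 p) = firstForm e x p 1 1 := rfl
    have hyX : ∀ j, inner ℝ (y p) (pd e x j p) = t₀ * inner ℝ (pd e x 0 p) (pd e x j p) +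
        t₁ * inner ℝ (pd e x 1 p) (pd e x j p) := fun j => by
      conv_lhs => rw [ht]
      simp only [inner_add_left, inner_smul_left, horth, conj_trivial, mul_zero, zero_add]
    have haX : ∀ j, inner ℝ (yAff x ξ p) (pd e x j p) = τ₀ * inner ℝ (pd e x 0 p) (pd e x j p) +
        τ₁ * inner ℝ (pd e x 1 p) (pd e x j p) := fun j => by
      conv_lhs => rw [hτ]
      simp only [inner_add_left, inner_smul_left, horth, conj_trivial, mul_zero, zero_add]
    rw [h01] at hdet
    simp only [hHdef, trace_shapeCoeff, hZi, inner_sub_left, inner_add_left, inner_smul_left,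
      conj_trivial, hyX, haX, e00, e01, e10, e11, h01]
    generalize (firstForm e x p).det = D at hD' hdet
    field_simp
    rw [hdet]
    ring
  have hc : c p = qa ^ 2 / q := rfl
  have hq0 : q ≠ 0 := h0 p
  -- The defect is half the square of the `II`-length of the difference field.
  have hE : curvDefect x ξ y p = 1 / 2 * (h 0 0 * (t₀ / q - τ₀ / qa) ^ 2 +
      2 * h 0 1 * ((t₀ / q - τ₀ / qa) * (t₁ / q - τ₁ / qa)) +
      h 1 1 * (t₁ / q - τ₁ / qa) ^ 2) := by
    have hci' : ∀ i, pd e c i p = (2 * qa * pd e (qAff x ξ) i p -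
      c p * pd e (support ξ y) i p) / q := fun i => by rw [← hci]; field_simp
    have hE' : curvDefect x ξ y p = relMeanCurv x y p / q - relMeanCurv x (yAff x ξ) p / qa -
      relMeanCurv x (diffField x ξ y) p / qa ^ 2 := rfl
    rw [hE', hR, hci', hci', hc, hqi, hqi, hqai, hqai, hsymm]
    field_simp
    ring
  have hquad : 1 / 2 * (h 0 0 * (t₀ / q - τ₀ / qa) ^ 2 +
      2 * h 0 1 * ((t₀ / q - τ₀ / qa) * (t₁ / q - τ₁ / qa)) +
      h 1 1 * (t₁ / q - τ₁ / qa) ^ 2) = 1 / 2 *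
        (star ![t₀ / q - τ₀ / qa, t₁ / q - τ₁ / qa] ⬝ᵥ
          h.mulVec ![t₀ / q - τ₀ / qa, t₁ / q - τ₁ / qa]) := by
    simp [Matrix.mulVec, dotProduct, Fin.sum_univ_two, hsymm]
    ring
  rw [hE, hquad]
  refine ⟨mul_nonneg (by norm_num) (hPD.posSemidef.dotProduct_mulVec_nonneg _), fun hzero => ?_⟩
  have hw : ![t₀ / q - τ₀ / qa, t₁ / q - τ₁ / qa] = 0 := by
    by_contra hne
    have := hPD.dotProduct_mulVec_pos hne
    linarith
  have hw0 : t₀ / q - τ₀ / qa = 0 := congrFun hw 0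
  have hw1 : t₁ / q - τ₁ / qa = 0 := congrFun hw 1
  have ht0 : t₀ = q / qa * τ₀ := by field_simp at hw0 ⊢; linarith
  have ht1 : t₁ = q / qa * τ₁ := by field_simp at hw1 ⊢; linarith
  rw [ht, hτ, ht0, ht1, smul_add, smul_add, smul_smul, smul_smul, smul_smul,
    div_mul_cancel₀ _ hqa0]

/-- A `C^1` function on a connected surface with vanishing partial derivatives is constant. -/
theorem exists_eq_const_of_pd_eq_zero [ConnectedSpace M] {f : M → ℝ}
    (hf : ContMDiff (𝓡 2) 𝓘(ℝ, ℝ) 1 f) (h : ∀ p i, pd (chartAt E2 p) f i p = 0) :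
    ∃ c, ∀ p, f p = c := by
  have hloc : IsLocallyConstant f := by
    refine (IsLocallyConstant.iff_eventually_eq f).2 fun p => ?_
    have he := chart_mem_atlas E2 p
    have hp := mem_chart_source E2 p
    set e := chartAt E2 p
    have hfe := chartContDiff_of_contMDiff hf he
    obtain ⟨ε, hε, hball⟩ := Metric.isOpen_iff.1 e.open_target _ (e.map_source hp)
    have hder : Set.EqOn (fderiv ℝ (f ∘ e.symm)) 0 (Metric.ball (e p) ε) := by
      intro u hu
      have hm := e.map_target (hball hu)
      have h1 : ∀ i, fderiv ℝ (f ∘ e.symm) u (EuclideanSpace.single i 1) = 0 := by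
        intro i
        have h2 := pd_change (chart_mem_atlas E2 (e.symm u)) he (mem_chart_source E2 _) hm
          ((chartContDiff_of_contMDiff hf (chart_mem_atlas E2 (e.symm u))).differentiableAt le_rfl
            (mem_chart_source E2 _)) i
        simp only [h, smul_zero, Finset.sum_const_zero] at h2
        simpa [pd, e.right_inv (hball hu)] using h2
      refine ContinuousLinearMap.coe_injective
        ((EuclideanSpace.basisFun (Fin 2) ℝ).toBasis.ext fun i => ?_)
      simpa using h1 i
    have hconst : ∀ u ∈ Metric.ball (e p) ε, (f ∘ e.symm) u = (f ∘ e.symm) (e p) := fun u hu =>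
      Metric.isOpen_ball.is_const_of_fderiv_eq_zero (convex_ball _ _).isPreconnected
        ((ContDiffOn.differentiableOn hfe one_ne_zero).mono hball) hder hu
        (Metric.mem_ball_self hε)
    filter_upwards [e.open_source.mem_nhds hp,
      (e.continuousAt hp).eventually (Metric.ball_mem_nhds _ hε)] with m hm hmb
    simpa [e.left_inv hm, e.left_inv hp] using hconst (e m) hmb
  obtain ⟨p₀⟩ := (inferInstance : Nonempty M)
  exact ⟨f p₀, fun p => hloc.apply_eq_of_preconnectedSpace p p₀⟩

theorem relMeanCurv_const_smul (hy : ContMDiff (𝓡 2) 𝓘(ℝ, E3) 1 y) (c : ℝ) (p : M) :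
    relMeanCurv x (fun m => c • y m) p = c * relMeanCurv x y p := by
  have he := chart_mem_atlas E2 p
  have hp := mem_chart_source E2 p
  have h1 : ∀ i, pd (chartAt E2 p) (fun m => c • y m) i p = c • pd (chartAt E2 p) y i p := by
    intro i
    rw [pd_smul (differentiableAt_const c)
      ((chartContDiff_of_contMDiff hy he).differentiableAt le_rfl hp) hp, pd_const]
    simp
  simp only [relMeanCurv, trace_shapeCoeff, h1, inner_smul_left, conj_trivial]
  ring

theorem contMDiff_yAff (hx : IsPosCurvedSurface r x ξ) (hr : 4 ≤ r) :
    ContMDiff (𝓡 2) 𝓘(ℝ, E3) 1 (yAff x ξ) :=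
  contMDiff_of_chartContDiff fun q => chartContDiff_yAff hx
    (by rwa [show (1 : WithTop ℕ∞) + 3 = 4 by norm_num]) (chart_mem_atlas E2 q)

end Comparison

theorem four_le_of_three_lt {r : WithTop ℕ∞} (h : 3 < r) : 4 ≤ r := by
  induction r using WithTop.recTopCoe with
  | top => exact le_top
  | coe n =>
    have h1 : (3 : ℕ∞) < n := WithTop.coe_lt_coe.1 h
    have h2 := Order.add_one_le_of_lt h1
    rw [show (3 : ℕ∞) + 1 = 4 by norm_num] at h2
    exact WithTop.coe_le_coe.2 h2

end RelSurface

theorem proposition6 {M : Type*} [TopologicalSpace M] [T2Space M] [CompactSpace M]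
    [ConnectedSpace M] [MeasurableSpace M] [BorelSpace M] [ChartedSpace RelSurface.E2 M]
    (r s : WithTop ℕ∞) (hr : 3 ≤ r) (hs : 1 ≤ s) (hsr : s < r) [IsManifold (𝓡 2) r M]
    (x ξ y : M → RelSurface.E3)
    (hx : RelSurface.IsPosCurvedSurface r x ξ)
    (hII : ∀ p, (RelSurface.secondForm (chartAt RelSurface.E2 p) x ξ p).PosDef)
    (haff : r = 3 → ContMDiff (𝓡 2) 𝓘(ℝ, RelSurface.E3) 1 (RelSurface.yAff x ξ))
    (hy : RelSurface.IsRelativeNormalization s x y) :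
    Integrable (fun p => RelSurface.relMeanCurv x y p / RelSurface.support ξ y p -
        RelSurface.relMeanCurv x (RelSurface.yAff x ξ) p / RelSurface.qAff x ξ p)
      (RelSurface.areaII x ξ) ∧
    0 ≤ ∫ p, (RelSurface.relMeanCurv x y p / RelSurface.support ξ y p -
        RelSurface.relMeanCurv x (RelSurface.yAff x ξ) p / RelSurface.qAff x ξ p)
      ∂(RelSurface.areaII x ξ) ∧
    (∫ p, (RelSurface.relMeanCurv x y p / RelSurface.support ξ y p -
        RelSurface.relMeanCurv x (RelSurface.yAff x ξ) p / RelSurface.qAff x ξ p)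
      ∂(RelSurface.areaII x ξ) = 0 ↔
      ∃ c : ℝ, c ≠ 0 ∧ ∀ p, y p = c • RelSurface.yAff x ξ p) := by
  have hr2 : (2 : WithTop ℕ∞) ≤ r := le_trans (by norm_num) hr
  have hr1 : (1 : WithTop ℕ∞) ≤ r := le_trans (by norm_num) hr
  have : IsManifold (𝓡 2) 1 M := .of_le hr1
  have ha : ContMDiff (𝓡 2) 𝓘(ℝ, RelSurface.E3) 1 (RelSurface.yAff x ξ) := by
    rcases eq_or_lt_of_le hr with h | h
    · exact haff h.symm
    · exact RelSurface.contMDiff_yAff hx (RelSurface.four_le_of_three_lt h)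
  have hy1 := hy.contMDiff.of_le hs
  have h0 := RelSurface.support_ne_zero hx hr1 hy
  have hqa0 := fun m => (RelSurface.qAff_pos hx m).ne'
  have hqac := RelSurface.contMDiff_qAff hx hr
  have hqc := RelSurface.contMDiff_support hx hr2 hy1
  have hfin := RelSurface.isFiniteMeasure_areaII hx hr2
  have hopen := RelSurface.isOpenPosMeasure_areaII hx hr2
  have hZ := RelSurface.contMDiff_diffField hx hr ha hy1 h0
  have hc1 := RelSurface.continuous_relMeanCurv_div hx hr2 hy1 hqc.continuous h0
  have hc2 := RelSurface.continuous_relMeanCurv_div hx hr2 ha hqac.continuous hqa0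
  have hc3 : Continuous fun m => RelSurface.relMeanCurv x (RelSurface.diffField x ξ y) m /
      RelSurface.qAff x ξ m ^ 2 := RelSurface.continuous_relMeanCurv_div hx hr2 hZ
    (hqac.continuous.pow 2) fun m => pow_ne_zero 2 (hqa0 m)
  have hEc : Continuous (RelSurface.curvDefect x ξ y) := (hc1.sub hc2).sub hc3
  have hI1 := (hc1.sub hc2).integrable_of_hasCompactSupport (μ := RelSurface.areaII x ξ)
    (HasCompactSupport.of_compactSpace _)
  have hI3 := hc3.integrable_of_hasCompactSupport (μ := RelSurface.areaII x ξ)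
    (HasCompactSupport.of_compactSpace _)
  have hE := RelSurface.curvDefect_nonneg_and_eq hx hr hII ha hs hy
  have hint : ∫ p, (RelSurface.relMeanCurv x y p / RelSurface.support ξ y p -
        RelSurface.relMeanCurv x (RelSurface.yAff x ξ) p / RelSurface.qAff x ξ p)
      ∂(RelSurface.areaII x ξ) = ∫ p, RelSurface.curvDefect x ξ y p ∂(RelSurface.areaII x ξ) := by
    have h1 := integral_sub hI1 hI3
    rw [RelSurface.integral_relMeanCurv_eq_zero hx hr hZ
      fun m => RelSurface.inner_normal_diffField hx (h0 m), sub_zero] at h1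
    exact h1.symm
  refine ⟨hI1, ?_, ?_, ?_⟩
  · rw [hint]
    exact integral_nonneg fun p => (hE p).1
  · intro hzero
    rw [hint, integral_eq_zero_iff_of_nonneg (fun p => (hE p).1)
      (hEc.integrable_of_hasCompactSupport (HasCompactSupport.of_compactSpace _)),
      hEc.ae_eq_iff_eq _ continuous_zero] at hzero
    have hyq := fun p => (hE p).2 (congrFun hzero p)
    -- Both `y` and `y_aff` solve `∂ᵢ q = ⟨∂ᵢ ξ, y⟩`, so `q / q_aff` has vanishing derivatives.
    have hφc : ContMDiff (𝓡 2) 𝓘(ℝ, ℝ) 1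
        fun m => RelSurface.support ξ y m / RelSurface.qAff x ξ m := hqc.div₀ hqac hqa0
    obtain ⟨c, hc⟩ := RelSurface.exists_eq_const_of_pd_eq_zero hφc fun p i => by
      have he := chart_mem_atlas RelSurface.E2 p
      have hp := mem_chart_source RelSurface.E2 p
      have hφ := (RelSurface.chartContDiff_of_contMDiff hφc he).differentiableAt le_rfl hp
      have hqd := (RelSurface.chartContDiff_of_contMDiff hqac he).differentiableAt le_rfl hp
      have h1 := RelSurface.pd_mul hφ hqd hp i
      rw [RelSurface.pd_congr (g := RelSurface.support ξ y) (fun m _ => div_mul_cancel₀ _ (hqa0 m))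
        hp, RelSurface.pd_support hx hr2 hs hy, hyq p, inner_smul_right,
        RelSurface.inner_pd_normal_yAff hx hr he hp] at h1
      have h2 := right_eq_add.1 h1
      exact (mul_eq_zero.1 h2).resolve_right (hqa0 p)
    obtain ⟨p₀⟩ := (inferInstance : Nonempty M)
    refine ⟨c, ?_, fun p => ?_⟩
    · rw [← hc p₀]
      exact div_ne_zero (h0 p₀) (hqa0 p₀)
    · rw [← hc p]
      exact hyq p
  · rintro ⟨c, hc, hyc⟩
    obtain rfl : y = fun m => c • RelSurface.yAff x ξ m := funext hyc
    refine integral_eq_zero_of_ae (Filter.Eventually.of_forall fun p => ?_)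
    have h1 : RelSurface.support ξ (fun m => c • RelSurface.yAff x ξ m) p =
        c * RelSurface.qAff x ξ p := by
      rw [← RelSurface.support_yAff hx p]
      exact inner_smul_right _ _ _
    simp only [RelSurface.relMeanCurv_const_smul ha, h1, Pi.zero_apply]
    rw [mul_div_mul_left _ _ hc, sub_self]
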